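/- Let $p>0$, let $K$ be a field of characteristic $p$, let $n\ge 1$, and let $d_1,\dots,d_n\ge 2$ be integers. Let $A=K[x_1,\dots,x_n]/(x_1^{d_1},\dots,x_n^{d_n})=\bigoplus_{i\ge0}A_i$ with the standard grading. One says that $A$ has the strong Lefschetz property (SLP) if there is a linear form $\ell\in A_1$ such that, for all $i\ge 0$ and $m\ge 1$, the multiplication map $\cdot\,\ell^m\colon A_i\to A_{i+m}$ is injective or surjective. Write each $d_i$ in base $p$ as $d_i=c_{ik_i}p^{k_i}+\dots+c_{i1}p+c_{i0}$, with $0\le c_{ij}<p$ and $c_{ik_i}\neq 0$. Then $A$ has the SLP if and only if one of the following conditions holds. 1. $n=1$. 2. $n=2$, $p=2$, and, with the variables numbered so that $d_1\le d_2$, one of the following holds: - $d_1=2$ and $c_{20}=1$; - $d_1=3$, $c_{21}=1$ and $c_{20}=0$. 3. $n=2$, $p>2$, and, with the variables numbered so that $k_1\le k_2$, all of the following hold: - $c_{10}\in\{\frac{p-1}{2},\frac{p+1}{2}\}$ and $c_{20}\in\{\frac{p-1}{2},\frac{p+1}{2}\}$; - $c_{1j}=c_{2j}=\frac{p-1}{2}$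 for $j=1,\dots,k_1-1$; - $c_{1k_1}+c_{2k_1}<p$, and $c_{2k_1}\ge c_{1k_1}$ if $k_1<k_2$. 4. $n\ge 2$ and $\sum_{i=1}^n(d_i-1)<p$. 5. $n\ge 2$ and there is a $j$ such that $d_j\ge p$, $d_i<p$ for all $i\ne j$, and $\sum_{i\ne j}(d_i-1)\le\min(c_{j0},\,p-c_{j0})$. -/

import Mathlib

/-!
Monomial complete intersections, their standard grading, the strong Lefschetz property, and
base `p` digits.
-/

open MvPolynomial

section Lefschetz

variable {K A : Type*} [Field K] [CommRing A] [Algebra K A]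

/-- Multiplication by a homogeneous element `f` of degree `d`, as the linear map
`𝒜 i → 𝒜 (i + d)`, `a ↦ f * a`. -/
def homogeneousMul (𝒜 : ℕ → Submodule K A) [GradedAlgebra 𝒜] {f : A} {d : ℕ} (hf : f ∈ 𝒜 d)
    (i : ℕ) : 𝒜 i →ₗ[K] 𝒜 (i + d) :=
  (LinearMap.mulLeft K f).restrict fun a ha => by
    have h := SetLike.mul_mem_graded hf ha
    rw [add_comm] at h
    exact h

/-- A linear map has maximal rank if it is injective or surjective. -/
def HasMaximalRank {V W : Type*} [AddCommGroup V] [Module K V] [AddCommGroup W] [Module K W]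
    (φ : V →ₗ[K] W) : Prop :=
  Function.Injective φ ∨ Function.Surjective φ

/-- The `m`-th power of an element of degree one has degree `m`. -/
theorem pow_mem_of_mem_one (𝒜 : ℕ → Submodule K A) [GradedAlgebra 𝒜] {l : A} (hl : l ∈ 𝒜 1)
    (m : ℕ) : l ^ m ∈ 𝒜 m := by
  have h := SetLike.pow_mem_graded m hl
  rw [smul_eq_mul, mul_one] at h
  exact h

/-- The strong Lefschetz property of a graded algebra: there is a linear form `l` such that all
the maps `l ^ m : 𝒜 i → 𝒜 (i + m)`, for `i ≥ 0` and `m ≥ 1`, have maximal rank. -/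
def HasStrongLefschetzProperty (𝒜 : ℕ → Submodule K A) [GradedAlgebra 𝒜] : Prop :=
  ∃ (l : A) (hl : l ∈ 𝒜 1), ∀ i m : ℕ, 1 ≤ m →
    HasMaximalRank (homogeneousMul 𝒜 (pow_mem_of_mem_one 𝒜 hl m) i)

end Lefschetz

section MonomialCompleteIntersection

variable (K : Type*) [Field K] {n : ℕ} (d : Fin n → ℕ)

/-- The monomial complete intersection `K[x₁, …, xₙ] / (x₁ ^ d₁, …, xₙ ^ dₙ)`. -/
abbrev MonomialCI : Type _ :=
  MvPolynomial (Fin n) K ⧸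
    Ideal.span (Set.range fun i : Fin n => (X i ^ d i : MvPolynomial (Fin n) K))

/-- The degree `i` part of a monomial complete intersection: the classes of the homogeneous
polynomials of degree `i`. -/
noncomputable def MonomialCI.degreePart (i : ℕ) : Submodule K (MonomialCI K d) :=
  (homogeneousSubmodule (Fin n) K i).map
    (Ideal.Quotient.mkₐ K
      (Ideal.span (Set.range fun i : Fin n => (X i ^ d i : MvPolynomial (Fin n) K)))).toLinearMap

namespace MonomialCI

theorem mk_mem_degreePart {i : ℕ} {f : MvPolynomial (Fin n) K} (hf : f.IsHomogeneous i) :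
    (Ideal.Quotient.mk _ f : MonomialCI K d) ∈ degreePart K d i :=
  ⟨f, hf, rfl⟩

instance : SetLike.GradedMonoid (degreePart K d) where
  one_mem := mk_mem_degreePart K d (isHomogeneous_one _ _)
  mul_mem := by
    rintro i j _ _ ⟨f, hf, rfl⟩ ⟨g, hg, rfl⟩
    exact ⟨f * g, IsHomogeneous.mul hf hg, map_mul (Ideal.Quotient.mkₐ K _) f g⟩

/-- The algebra map that sends each variable to its class, placed in degree one. -/
noncomputable def toDirectSumAux :
    MvPolynomial (Fin n) K →ₐ[K] DirectSum ℕ fun i => degreePart K d i :=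
  aeval fun j => DirectSum.of (fun i => degreePart K d i) 1
    ⟨Ideal.Quotient.mk _ (X j), mk_mem_degreePart K d (isHomogeneous_X _ _)⟩

theorem coe_toDirectSumAux (f : MvPolynomial (Fin n) K) :
    DirectSum.coeAlgHom (degreePart K d) (toDirectSumAux K d f) = Ideal.Quotient.mk _ f := by
  have h : (DirectSum.coeAlgHom (degreePart K d)).comp (toDirectSumAux K d) =
      Ideal.Quotient.mkₐ K _ := by
    apply MvPolynomial.algHom_ext
    intro j
    rw [AlgHom.comp_apply, toDirectSumAux, aeval_X, DirectSum.coeAlgHom_of]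
    rfl
  exact DFunLike.congr_fun h f

theorem exists_toDirectSumAux_monomial (s : Fin n →₀ ℕ) (c : K) (m : ℕ) (hm : s.degree = m) :
    ∃ y, toDirectSumAux K d (monomial s c) = DirectSum.of (fun i => degreePart K d i) m y := by
  induction s using Finsupp.induction_linear generalizing c m with
  | zero =>
    rw [map_zero] at hm
    subst hm
    exact ⟨_, (AlgHom.commutes (toDirectSumAux K d) c).trans (DirectSum.algebraMap_apply _ _ c)⟩
  | add s t hs ht =>
    obtain ⟨y, hy⟩ := hs c _ rfl
    obtain ⟨z, hz⟩ := ht 1 _ rfl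
    rw [map_add] at hm
    subst hm
    have hst : (monomial (s + t) c : MvPolynomial (Fin n) K) = monomial s c * monomial t 1 := by
      rw [monomial_mul, mul_one]
    rw [hst, map_mul, hy, hz, DirectSum.of_mul_of]
    exact ⟨_, rfl⟩
  | single j k =>
    have hk : 0 + k • 1 = m := by simpa using hm
    subst hk
    rw [← C_mul_X_pow_eq_monomial, map_mul, map_pow, ← algebraMap_eq, AlgHom.commutes,
      DirectSum.algebraMap_apply, toDirectSumAux, aeval_X, DirectSum.ofPow, DirectSum.of_mul_of]
    exact ⟨_, rfl⟩

theorem toDirectSumAux_of_isHomogeneous {i : ℕ} {f : MvPolynomial (Fin n) K}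
    (hf : f.IsHomogeneous i) :
    toDirectSumAux K d f =
      DirectSum.of (fun i => degreePart K d i) i
        ⟨Ideal.Quotient.mk _ f, mk_mem_degreePart K d hf⟩ := by
  have hex : ∃ y, toDirectSumAux K d f = DirectSum.of (fun i => degreePart K d i) i y := by
    have hr : toDirectSumAux K d f ∈
        AddMonoidHom.range (DirectSum.of (fun i => degreePart K d i) i) := by
      rw [f.as_sum, map_sum]
      refine sum_mem fun s hs => ?_
      have hi : s.degree = i := by
        rw [Finsupp.degree_eq_weight_one]
        exact hf (mem_support_iff.1 hs)
      obtain ⟨y, hy⟩ := exists_toDirectSumAux_monomial K d s (coeff s f) i hi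
      exact ⟨y, hy.symm⟩
    obtain ⟨y, hy⟩ := hr
    exact ⟨y, hy.symm⟩
  obtain ⟨y, hy⟩ := hex
  have h := coe_toDirectSumAux K d f
  rw [hy, DirectSum.coeAlgHom_of] at h
  rw [hy]
  exact congrArg _ (Subtype.ext h)

/-- The decomposition of a monomial complete intersection into its degree parts. -/
noncomputable def toDirectSum :
    MonomialCI K d →ₐ[K] DirectSum ℕ fun i => degreePart K d i :=
  Ideal.Quotient.liftₐ _ (toDirectSumAux K d) fun a ha => by
    have hle : Ideal.span (Set.range fun i : Fin n => (X i ^ d i : MvPolynomial (Fin n) K)) ≤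
        RingHom.ker (toDirectSumAux K d) := by
      rw [Ideal.span_le]
      rintro _ ⟨j, rfl⟩
      have hX : (X j ^ d j : MvPolynomial (Fin n) K).IsHomogeneous (d j) := isHomogeneous_X_pow _ _
      have h0 : (Ideal.Quotient.mk _ (X j ^ d j) : MonomialCI K d) = 0 :=
        Ideal.Quotient.eq_zero_iff_mem.2 (Ideal.subset_span ⟨j, rfl⟩)
      rw [SetLike.mem_coe, RingHom.mem_ker]
      refine (toDirectSumAux_of_isHomogeneous K d hX).trans ?_
      rw [← map_zero (DirectSum.of (fun i => degreePart K d i) (d j))]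
      exact congrArg _ (Subtype.ext h0)
    exact hle ha

noncomputable instance : GradedAlgebra (degreePart K d) :=
  GradedAlgebra.ofAlgHom _ (toDirectSum K d)
    (by
      apply Ideal.Quotient.algHom_ext
      apply AlgHom.ext
      intro f
      exact coe_toDirectSumAux K d f)
    (by
      rintro i ⟨_, f, hf, rfl⟩
      exact toDirectSumAux_of_isHomogeneous K d hf)

end MonomialCI

end MonomialCompleteIntersection

/-- The coefficient of `p ^ j` in the base `p` expansion of `m`. -/
def baseDigit (p m j : ℕ) : ℕ := (Nat.digits p m).getD j 0

/-- The index of the leading digit in the base `p` expansion of `m ≥ 1`. -/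
def topIndex (p m : ℕ) : ℕ := (Nat.digits p m).length - 1

/-!
The strong Lefschetz property of `A = K[x₁, …, xₙ] / (x₁ ^ d₁, …, xₙ ^ dₙ)` is tested on linear
forms `ℓ = ∑ cⱼ xⱼ` with all `cⱼ ≠ 0`, since the power of `ℓ` that maps `A₀` to the socle vanishes
if a variable is missing (`LefschetzOn.coeff_ne_zero`). By the symmetry of the Hilbert function,
the property says that `ℓ ^ (t - 2 * i)` is injective, or equivalently surjective, from degree `i`
to degree `t - i`, where `t` is the socle degree. The predicate `LefschetzOn d c T` states this for
the subalgebra of `A` generated by the variables in a set `T`, so that one can add variables one at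
a time without leaving `A`.

Two variables. For `K[z, y] / (z ^ s, y ^ d)` and `ℓ = z + y`, the relevant maps have the matrices
`binomMatrix K A B C` with `A + B = s` and `A + C = d`, and MacMahon's product formula
(`binomMatrix_det_mul`) evaluates the determinants. By Legendre's formula a prime power `q` does
not contribute to the `p`-adic valuation of the determinant exactly when the residues of `A`, `B`,
`C` modulo `q` satisfy `DigitCompatible q A B C` (`not_dvd_det_binomMatrix_iff`). Quantifying over
`A` leaves a condition on the residues of `s` and `d` modulo each power of `p`
(`PrimePowerCondition`, `twoVarLefschetz_iff`), and this is a condition on their base `p` digits.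

Adding a variable. If the algebra of `T` has the property, it is spanned by the elements `ℓ ^ u * a`
with `a` primitive, that is, `a` of degree `i` and annihilated by `ℓ ^ (t - 2 * i + 1)`
(`LefschetzOn.subPart_le`). Each nonzero primitive `a` generates a copy of `K[z] / (z ^ s)` with
`s = t - 2 * i + 1`, centred in degree `t / 2`. Hence the algebra with one more variable `xⱼ` has
the property if and only if that of `T` has it (`LefschetzOn.of_insert`) and
`K[z, y] / (z ^ s, y ^ dⱼ)` has it for all these `s` (`LefschetzOn.twoVarLefschetz`,
`LefschetzOn.insert`).

Several variables. Restricting to pairs of variables excludes `n ≥ 3` for `p = 2`, by parity. For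
odd `p`, if two exponents are at least `p`, then the lengths `s` for these two variables cover all
residues modulo `p`, and a length divisible by `p` is incompatible with a third variable
(`not_lefschetzOn_triple`). If at most one exponent is at least `p`, the primitive element `1`, of
length `s = t + 1`, gives the bounds on `∑ (dᵢ - 1)`, and these bounds suffice
(`LefschetzOn.topDeg_lt`, `lefschetzOn_of_topDeg_lt`, `lefschetzOn_insert_iff`).
-/

/-! ### Determinants of binomial coefficients -/

open Nat in
/-- The falling factorials are monic polynomials of degree `r`, so this is a Vandermonde
determinant at consecutive integers. -/
theorem det_descFactorial (C A : ℕ) :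
    (Matrix.of fun s r : Fin A => ((C + s).descFactorial r : ℤ)).det =
      ∏ s ∈ Finset.range A, ((s ! : ℕ) : ℤ) := by
  cases A with
  | zero => simp
  | succ m =>
    have h := Matrix.det_eval_matrixOfPolynomials_eq_det_vandermonde
      (fun i : Fin (m + 1) => (i : ℤ) + (C : ℤ)) (fun i => descPochhammer ℤ i)
      (fun i => descPochhammer_natDegree ℤ i) (fun i => monic_descPochhammer ℤ i)
    rw [Matrix.det_vandermonde_add, Matrix.det_vandermonde_id_eq_superFactorial] at h
    rw [← Nat.cast_prod, Nat.prod_range_succ_factorial, h]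
    congr 1
    ext s r
    simp only [Matrix.of_apply]
    rw [add_comm, ← Nat.cast_add, descPochhammer_eval_eq_descFactorial]

/-- The matrix, with respect to monomial bases, of multiplication by `(z + y) ^ (B + C)` from
degree `A - 1` to degree `A + B + C - 1` of `K[z, y] / (z ^ (A + B), y ^ (A + C))`. -/
def binomMatrix (R : Type*) [Semiring R] (A B C : ℕ) : Matrix (Fin A) (Fin A) R :=
  Matrix.of fun r u => if (u : ℕ) ≤ B + r then (((B + C).choose (B + r - u) : ℕ) : R) else 0

theorem binomMatrix_map_intCast (R : Type*) [CommRing R] (A B C : ℕ) :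
    ((binomMatrix ℤ A B C).det : R) = (binomMatrix R A B C).det := by
  rw [Int.cast_det]
  congr 1
  ext r u
  by_cases h : (u : ℕ) ≤ B + r <;> simp [binomMatrix, h]

open Nat in
/-- Column operations, by the Vandermonde identity, make the columns of `binomMatrix` segments of
successive rows of Pascal's triangle. -/
theorem binomMatrix_mul_choose (A B C : ℕ) :
    binomMatrix ℤ A B C * (Matrix.of fun u s : Fin A => (((s : ℕ).choose u : ℕ) : ℤ)) =
      Matrix.of fun r s : Fin A => (((B + C + s).choose (B + r) : ℕ) : ℤ) := by
  ext r s
  rw [Matrix.mul_apply, Matrix.of_apply, add_comm (B + C) (s : ℕ), Nat.add_choose_eq,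
    Finset.Nat.sum_antidiagonal_eq_sum_range_succ_mk]
  simp only [binomMatrix, Matrix.of_apply]
  set f : ℕ → ℤ := fun u => (if u ≤ B + r then (((B + C).choose (B + r - u) : ℕ) : ℤ) else 0) *
    (((s : ℕ).choose u : ℕ) : ℤ) with hf
  have h1 : Finset.range A ⊆ Finset.range (A + (B + r + 1)) :=
    Finset.range_subset_range.2 (by omega)
  have h2 : Finset.range (B + r + 1) ⊆ Finset.range (A + (B + r + 1)) :=
    Finset.range_subset_range.2 (by omega)
  have h3 : ((∑ u ∈ Finset.range (B + r).succ, (s : ℕ).choose u * (B + C).choose (B + r - u) : ℕ)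
      : ℤ) = ∑ u ∈ Finset.range (B + r + 1), f u := by
    rw [Nat.cast_sum]
    refine Finset.sum_congr rfl fun u hu => ?_
    rw [Finset.mem_range] at hu
    rw [hf]
    simp only
    rw [if_pos (by omega), Nat.cast_mul, mul_comm]
  rw [h3, Fin.sum_univ_eq_sum_range f A, Finset.sum_subset h1, Finset.sum_subset h2]
  · intro u _ hu
    simp only [Finset.mem_range, not_lt] at hu
    simp only [hf]
    rw [if_neg (by omega), zero_mul]
  · intro u _ hu
    simp only [Finset.mem_range, not_lt] at hu
    simp only [hf]
    rw [Nat.choose_eq_zero_of_lt (lt_of_lt_of_le s.2 hu)]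
    simp

theorem det_choose (A : ℕ) :
    (Matrix.of fun u s : Fin A => (((s : ℕ).choose u : ℕ) : ℤ)).det = 1 := by
  rw [Matrix.det_of_isUpperTriangular]
  · simp
  · intro i j hij
    have : ((j : ℕ) : ℕ) < i := hij
    simp [Nat.choose_eq_zero_of_lt this]

open Nat in
/-- The MacMahon product formula for the determinant of `binomMatrix`, with denominators
cleared. -/
theorem binomMatrix_det_mul (A B C : ℕ) :
    (binomMatrix ℤ A B C).det *
        ((∏ s ∈ Finset.range A, ((B + s)! * (C + s)!) : ℕ) : ℤ) =
      ((∏ s ∈ Finset.range A, ((B + C + s)! * s !) : ℕ) : ℤ) := by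
  have hdet : (binomMatrix ℤ A B C).det =
      (Matrix.of fun r s : Fin A => (((B + C + s).choose (B + r) : ℕ) : ℤ)).det := by
    rw [← binomMatrix_mul_choose, Matrix.det_mul, det_choose, mul_one]
  have hentry : ∀ r s : ℕ, ((B + r)! * (C + s)! ) * (B + C + s).choose (B + r) =
      (B + C + s)! * (C + s).descFactorial r := by
    intro r s
    have h1 := Nat.descFactorial_eq_factorial_mul_choose (B + C + s) (B + r)
    have h2 := Nat.descFactorial_mul_descFactorial (k := B) (m := B + r) (n := B + C + s)
      (by omega)
    have h3 := Nat.factorial_mul_descFactorial (k := B) (n := B + C + s) (by omega)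
    rw [show B + C + s - B = C + s by omega] at h2 h3
    rw [show B + r - B = r by omega] at h2
    calc _ = (C + s)! * ((B + r)! * (B + C + s).choose (B + r)) := by ring
      _ = _ := by rw [← h1, ← h2, ← h3]; ring
  -- Scaling rows and columns turns the binomial coefficients into falling factorials.
  have hl : (∏ s : Fin A, ((C + s)! : ℤ)) * ((∏ r : Fin A, ((B + r)! : ℤ)) *
      (Matrix.of fun r s : Fin A => (((B + C + s).choose (B + r) : ℕ) : ℤ)).det) =
      (∏ s : Fin A, ((B + C + s)! : ℤ)) *
        (Matrix.of fun s r : Fin A => ((C + s).descFactorial r : ℤ)).det := by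
    rw [← Matrix.det_mul_column, ← Matrix.det_mul_row, ← Matrix.det_mul_column,
      ← Matrix.det_transpose]
    congr 1
    ext s r
    have := hentry r s
    simp only [Matrix.transpose_apply, Matrix.of_apply]
    rw [← mul_assoc, mul_comm ((C + s)! : ℤ)]
    exact_mod_cast this
  rw [det_descFactorial] at hl
  rw [hdet, Finset.prod_mul_distrib, Finset.prod_mul_distrib]
  push_cast
  rw [Fin.prod_univ_eq_prod_range (fun s => ((C + s)! : ℤ)),
    Fin.prod_univ_eq_prod_range (fun s => ((B + s)! : ℤ)),
    Fin.prod_univ_eq_prod_range (fun s => ((B + C + s)! : ℤ))] at hl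
  rw [← hl]
  ring

/-! ### Divisibility of the determinants by a prime -/

/-- The condition on `A`, `B`, `C` modulo `q` under which the prime power `q` does not contribute
to the valuation of `det (binomMatrix A B C)`. -/
def DigitCompatible (q A B C : ℕ) : Prop :=
  A % q = 0 ∨ B % q = 0 ∨ C % q = 0 ∨ A % q + B % q + C % q ≤ q ∨
    2 * q ≤ A % q + B % q + C % q

/-- For these ranges the quotient is at most `2`, and it jumps at the two multiples of `q`; the
differences are truncated. -/
theorem sum_range_add_div {q m A : ℕ} (hm : m ≤ 2 * q) (hA : A ≤ q) :
    ∑ s ∈ Finset.range A, (m + s) / q = (A - (q - m)) + (A - (2 * q - m)) := by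
  induction A with
  | zero => simp
  | succ A ih =>
    rw [Finset.sum_range_succ, ih (by omega)]
    have hq : 0 < q := by omega
    have h1 := Nat.div_add_mod (m + A) q
    have h2 := Nat.mod_lt (m + A) hq
    have h3 : (m + A) / q < 3 := (Nat.div_lt_iff_lt_mul hq).2 (by omega)
    generalize (m + A) / q = k at *
    interval_cases k <;> omega

/-- The contribution of the prime power `q` to the valuation of the factor with index `s` of the
product formula for `det (binomMatrix A B C)`. -/
def floorDefect (q B C s : ℕ) : ℤ :=
  ((B + C + s) / q : ℕ) + (s / q : ℕ) - ((B + s) / q : ℕ) - ((C + s) / q : ℕ)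

theorem floorDefect_mod {q : ℕ} (hq : 0 < q) (B C s : ℕ) :
    floorDefect q (B % q) (C % q) s = floorDefect q B C s := by
  have hB := Nat.mod_add_div B q
  have hC := Nat.mod_add_div C q
  have h1 : B + C + s = B % q + C % q + s + q * (B / q + C / q) := by
    rw [mul_add]; omega
  have h2 : B + s = B % q + s + q * (B / q) := by omega
  have h3 : C + s = C % q + s + q * (C / q) := by omega
  simp only [floorDefect]
  rw [h1, h2, h3, Nat.add_mul_div_left _ _ hq, Nat.add_mul_div_left _ _ hq,
    Nat.add_mul_div_left _ _ hq]
  push_cast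
  ring

theorem floorDefect_mul_add {q : ℕ} (hq : 0 < q) (B C s k : ℕ) :
    floorDefect q B C (q * k + s) = floorDefect q B C s := by
  simp only [floorDefect]
  rw [show B + C + (q * k + s) = B + C + s + q * k by ring,
    show B + (q * k + s) = B + s + q * k by ring, show C + (q * k + s) = C + s + q * k by ring,
    show q * k + s = s + q * k by ring, Nat.add_mul_div_left _ _ hq, Nat.add_mul_div_left _ _ hq,
    Nat.add_mul_div_left _ _ hq, Nat.add_mul_div_left _ _ hq]
  push_cast
  ring

theorem sum_floorDefect_of_lt {q A B C : ℕ} (hA : A ≤ q) (hB : B < q) (hC : C < q) :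
    ∑ s ∈ Finset.range A, floorDefect q B C s =
      ((A - (q - (B + C)) + (A - (2 * q - (B + C))) : ℕ) : ℤ) + ((A - q : ℕ) : ℤ)
        - ((A - (q - B) : ℕ) : ℤ) - ((A - (q - C) : ℕ) : ℤ) := by
  have h1 := sum_range_add_div (q := q) (m := B + C) (A := A) (by omega) hA
  have h2 := sum_range_add_div (q := q) (m := B) (A := A) (by omega) hA
  have h3 := sum_range_add_div (q := q) (m := C) (A := A) (by omega) hA
  have h4 := sum_range_add_div (q := q) (m := 0) (A := A) (by omega) hA
  simp only [zero_add] at h4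
  simp only [floorDefect, Finset.sum_sub_distrib, Finset.sum_add_distrib]
  rw [← Nat.cast_sum, ← Nat.cast_sum, ← Nat.cast_sum, ← Nat.cast_sum, h1, h2, h3, h4]
  omega

/-- The sum of `floorDefect` over a period vanishes, so only residues modulo `q` matter. -/
theorem sum_floorDefect_mod {q : ℕ} (hq : 0 < q) (A B C : ℕ) :
    ∑ s ∈ Finset.range (A % q), floorDefect q (B % q) (C % q) s =
      ∑ s ∈ Finset.range A, floorDefect q B C s := by
  have hB := Nat.mod_lt B hq
  have hC := Nat.mod_lt C hq
  have hper : ∀ k, ∑ s ∈ Finset.range (q * k), floorDefect q (B % q) (C % q) s = 0 := by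
    intro k
    induction k with
    | zero => simp
    | succ k ih =>
      rw [mul_add, mul_one, Finset.sum_range_add, ih]
      simp only [floorDefect_mul_add hq]
      rw [sum_floorDefect_of_lt le_rfl hB hC]
      omega
  conv_rhs => rw [← Nat.div_add_mod A q, Finset.sum_range_add]
  simp only [floorDefect_mul_add hq]
  simp only [← floorDefect_mod hq B C]
  rw [hper, zero_add]

theorem sum_floorDefect_nonneg {q : ℕ} (hq : 0 < q) (A B C : ℕ) :
    0 ≤ ∑ s ∈ Finset.range A, floorDefect q B C s := by
  have hA := Nat.mod_lt A hq
  have hB := Nat.mod_lt B hq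
  have hC := Nat.mod_lt C hq
  rw [← sum_floorDefect_mod hq, sum_floorDefect_of_lt hA.le hB hC]
  omega

theorem sum_floorDefect_eq_zero_iff {q : ℕ} (hq : 0 < q) (A B C : ℕ) :
    ∑ s ∈ Finset.range A, floorDefect q B C s = 0 ↔ DigitCompatible q A B C := by
  have hA := Nat.mod_lt A hq
  have hB := Nat.mod_lt B hq
  have hC := Nat.mod_lt C hq
  rw [← sum_floorDefect_mod hq, sum_floorDefect_of_lt hA.le hB hC, DigitCompatible]
  omega

open Nat in
theorem padicValNat_prod_factorial_add {p E : ℕ} [Fact p.Prime] (m A : ℕ) (h : m + A ≤ E) :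
    padicValNat p (∏ s ∈ Finset.range A, (m + s)!) =
      ∑ e ∈ Finset.Ico 1 (E + 1), ∑ s ∈ Finset.range A, (m + s) / p ^ e := by
  rw [Finset.sum_comm]
  induction A with
  | zero => simp
  | succ A ih =>
    have := Nat.log_le_self p (m + A)
    rw [Finset.prod_range_succ, Finset.sum_range_succ, padicValNat.mul
      (Finset.prod_ne_zero_iff.2 fun s _ => Nat.factorial_ne_zero _) (Nat.factorial_ne_zero _),
      ih (by omega), padicValNat_factorial (b := E + 1) (by omega)]

open Nat in
theorem not_dvd_det_binomMatrix_iff {p : ℕ} [Fact p.Prime] (A B C : ℕ) :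
    ¬ (p : ℤ) ∣ (binomMatrix ℤ A B C).det ↔ ∀ e, 1 ≤ e → DigitCompatible (p ^ e) A B C := by
  have hp : p.Prime := Fact.out
  have hq : ∀ e, 0 < p ^ e := fun e => pow_pos hp.pos e
  have hprod : ∀ m, ∏ s ∈ Finset.range A, (m + s)! ≠ 0 := fun m =>
    Finset.prod_ne_zero_iff.2 fun s _ => Nat.factorial_ne_zero _
  set D := (binomMatrix ℤ A B C).det.natAbs with hD
  have hmul : D * ((∏ s ∈ Finset.range A, (B + s)!) * ∏ s ∈ Finset.range A, (C + s)!) =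
      (∏ s ∈ Finset.range A, (B + C + s)!) * ∏ s ∈ Finset.range A, (0 + s)! := by
    have h := congrArg Int.natAbs (binomMatrix_det_mul A B C)
    rw [Int.natAbs_mul, Int.natAbs_natCast, Int.natAbs_natCast, Finset.prod_mul_distrib,
      Finset.prod_mul_distrib] at h
    simpa only [zero_add] using h
  have hD0 : D ≠ 0 := by
    intro h0
    rw [h0, zero_mul] at hmul
    exact mul_ne_zero (hprod _) (hprod _) hmul.symm
  have hval := congrArg (padicValNat p) hmul
  set E := A + B + C with hE
  rw [padicValNat.mul hD0 (mul_ne_zero (hprod _) (hprod _)),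
    padicValNat.mul (hprod _) (hprod _), padicValNat.mul (hprod _) (hprod _),
    padicValNat_prod_factorial_add (E := E) _ _ (by omega),
    padicValNat_prod_factorial_add (E := E) _ _ (by omega),
    padicValNat_prod_factorial_add (E := E) _ _ (by omega),
    padicValNat_prod_factorial_add (E := E) _ _ (by omega)] at hval
  have hsum : (padicValNat p D : ℤ) = ∑ e ∈ Finset.Ico 1 (E + 1),
      ∑ s ∈ Finset.range A, floorDefect (p ^ e) B C s := by
    simp only [floorDefect, Finset.sum_sub_distrib, Finset.sum_add_distrib]
    have := congrArg (Nat.cast : ℕ → ℤ) hval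
    simp only [zero_add, Nat.cast_add, Nat.cast_sum] at this
    linarith
  have h1 : ¬ (p : ℤ) ∣ (binomMatrix ℤ A B C).det ↔ (padicValNat p D : ℤ) = 0 := by
    rw [Nat.cast_eq_zero, padicValNat.eq_zero_iff, Int.natCast_dvd]
    exact ⟨fun h => Or.inr (Or.inr h), fun h => (h.resolve_left hp.ne_one).resolve_left hD0⟩
  rw [h1, hsum, Finset.sum_eq_zero_iff_of_nonneg fun e _ => sum_floorDefect_nonneg (hq e) _ _ _]
  constructor
  · intro h e he
    rcases lt_or_ge e (E + 1) with hlt | hge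
    · exact (sum_floorDefect_eq_zero_iff (hq e) _ _ _).1 (h e (Finset.mem_Ico.2 ⟨he, hlt⟩))
    · -- A prime power larger than `A + B + C` is compatible for trivial reasons.
      have h2 : E < p ^ e := lt_of_lt_of_le (by omega) (Nat.lt_pow_self hp.one_lt).le
      rw [DigitCompatible, Nat.mod_eq_of_lt (by omega : A < p ^ e),
        Nat.mod_eq_of_lt (by omega : B < p ^ e), Nat.mod_eq_of_lt (by omega : C < p ^ e)]
      omega
  · intro h e he
    exact (sum_floorDefect_eq_zero_iff (hq e) _ _ _).2 (h e (Finset.mem_Ico.1 he).1)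

/-- The algebra `K[z, y] / (z ^ s, y ^ d)` has the strong Lefschetz property with respect to
`z + y`, expressed by determinants. These concern the degrees `A - 1` with `A < min s d`; in the
higher degrees up to the middle the property holds in every characteristic. -/
def TwoVarLefschetz (K : Type*) [Field K] (s d : ℕ) : Prop :=
  ∀ A B C : ℕ, 1 ≤ A → 1 ≤ B → 1 ≤ C → A + B = s → A + C = d → (binomMatrix K A B C).det ≠ 0

theorem twoVarLefschetz_one_left (K : Type*) [Field K] (d : ℕ) : TwoVarLefschetz K 1 d := by
  intro A B C hA hB hC hs
  omega

section Numeric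

variable {K : Type*} [Field K] {p : ℕ} [Fact p.Prime] [CharP K p]

theorem twoVarLefschetz_iff_digitCompatible (s d : ℕ) :
    TwoVarLefschetz K s d ↔ ∀ A, 1 ≤ A → A < s → A < d → ∀ e, 1 ≤ e →
      DigitCompatible (p ^ e) A (s - A) (d - A) := by
  have key : ∀ A B C : ℕ, (binomMatrix K A B C).det ≠ 0 ↔
      ∀ e, 1 ≤ e → DigitCompatible (p ^ e) A B C := by
    intro A B C
    rw [← binomMatrix_map_intCast, Ne, CharP.intCast_eq_zero_iff K p, not_dvd_det_binomMatrix_iff]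
  constructor
  · intro h A hA hs hd
    exact (key _ _ _).1 (h A (s - A) (d - A) hA (by omega) (by omega) (by omega) (by omega))
  · rintro h A B C hA hB hC rfl rfl
    rw [key]
    simpa using h A hA (by omega) (by omega)

theorem twoVarLefschetz_comm (p : ℕ) [Fact p.Prime] [CharP K p] (s d : ℕ) :
    TwoVarLefschetz K s d ↔ TwoVarLefschetz K d s := by
  rw [twoVarLefschetz_iff_digitCompatible (p := p), twoVarLefschetz_iff_digitCompatible (p := p)]
  have h : ∀ q A B C, DigitCompatible q A B C ↔ DigitCompatible q A C B := by
    intro q A B C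
    simp only [DigitCompatible]
    omega
  exact ⟨fun H A h1 h2 h3 e he => (h _ _ _ _).1 (H A h1 h3 h2 e he),
    fun H A h1 h2 h3 e he => (h _ _ _ _).1 (H A h1 h3 h2 e he)⟩

/-- Subtraction of residues, with or without a borrow. -/
theorem sub_mod_eq {q a x : ℕ} (hx : x ≤ a) :
    (a - x) % q = if x % q ≤ a % q then a % q - x % q else a % q + q - x % q := by
  rcases Nat.eq_zero_or_pos q with rfl | hq
  · simp [hx]
  have ha := Nat.mod_add_div a q
  have hx' := Nat.mod_add_div x q
  have hal := Nat.mod_lt a hq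
  have hxl := Nat.mod_lt x hq
  have hle : x / q ≤ a / q := Nat.div_le_div_right hx
  split_ifs with h
  · obtain ⟨k, hk⟩ := Nat.exists_eq_add_of_le hle
    have : a - x = (a % q - x % q) + q * k := by
      rw [hk, mul_add] at ha; omega
    rw [this, Nat.add_mul_mod_self_left, Nat.mod_eq_of_lt (by omega)]
  · have hlt : x / q < a / q := by
      refine lt_of_le_of_ne hle fun heq => h ?_
      rw [heq] at hx'
      omega
    obtain ⟨k, hk⟩ := Nat.exists_eq_add_of_lt hlt
    have : a - x = (a % q + q - x % q) + q * k := by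
      rw [hk, mul_add, mul_add, mul_one] at ha; omega
    rw [this, Nat.add_mul_mod_self_left, Nat.mod_eq_of_lt (by omega)]

/-- The condition that a single prime power `q` imposes on `K[x, y] / (x ^ a, y ^ b)`, where
`a ≤ b`. -/
def PrimePowerCondition (q a b : ℕ) : Prop :=
  (q ≤ a → a % q ≤ b % q + 1 ∧ b % q ≤ a % q + 1 ∧ q ≤ a % q + b % q + 1 ∧
    a % q + b % q ≤ q + 1) ∧
  (a < q → a ≤ b % q + 1 ∧ a + b % q ≤ q + 1)

theorem digitCompatible_iff {q a b x : ℕ} (hxa : x ≤ a) (hxb : x ≤ b) :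
    DigitCompatible q x (a - x) (b - x) ↔ ∃ B C : ℕ,
      (x % q ≤ a % q ∧ B = a % q - x % q ∨ a % q < x % q ∧ B = a % q + q - x % q) ∧
      (x % q ≤ b % q ∧ C = b % q - x % q ∨ b % q < x % q ∧ C = b % q + q - x % q) ∧
      (x % q = 0 ∨ B = 0 ∨ C = 0 ∨ x % q + B + C ≤ q ∨ 2 * q ≤ x % q + B + C) := by
  rw [DigitCompatible, sub_mod_eq hxa, sub_mod_eq hxb]
  constructor
  · intro h
    exact ⟨_, _, by split_ifs <;> omega, by split_ifs <;> omega, h⟩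
  · rintro ⟨B, C, hB, hC, h⟩
    have h1 : (if x % q ≤ a % q then a % q - x % q else a % q + q - x % q) = B := by
      split_ifs <;> omega
    have h2 : (if x % q ≤ b % q then b % q - x % q else b % q + q - x % q) = C := by
      split_ifs <;> omega
    rwa [h1, h2]

/-- The values `1`, `q - 1`, `a % q - 1` and `b % q - 1` (and `a - 1` if `a < q`) of `A` are the
critical ones. -/
theorem forall_digitCompatible_iff {q a b : ℕ} (hq : 2 ≤ q) (ha : 2 ≤ a) (hab : a ≤ b) :
    (∀ A, 1 ≤ A → A < a → DigitCompatible q A (a - A) (b - A)) ↔ PrimePowerCondition q a b := by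
  have hal := Nat.mod_lt a (by omega : q > 0)
  have hbl := Nat.mod_lt b (by omega : q > 0)
  have haq : a < q → a % q = a := Nat.mod_eq_of_lt
  constructor
  · intro h
    have key : ∀ x, 1 ≤ x → x < a → x < q → ∃ B C : ℕ,
        (x ≤ a % q ∧ B = a % q - x ∨ a % q < x ∧ B = a % q + q - x) ∧
        (x ≤ b % q ∧ C = b % q - x ∨ b % q < x ∧ C = b % q + q - x) ∧
        (x = 0 ∨ B = 0 ∨ C = 0 ∨ x + B + C ≤ q ∨ 2 * q ≤ x + B + C) := by
      intro x h1 h2 h3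
      have := (digitCompatible_iff (q := q) h2.le (by omega)).1 (h x h1 h2)
      rwa [Nat.mod_eq_of_lt h3] at this
    rw [PrimePowerCondition]
    generalize a % q = α at *
    generalize b % q = β at *
    constructor
    · intro hqa
      refine ⟨?_, ?_, ?_, ?_⟩
      · by_contra! hc
        obtain ⟨B, C, h1, h2, h3⟩ := key (α - 1) (by omega) (by omega) (by omega)
        omega
      · by_contra! hc
        obtain ⟨B, C, h1, h2, h3⟩ := key (β - 1) (by omega) (by omega) (by omega)
        omega
      · by_contra! hc
        obtain ⟨B, C, h1, h2, h3⟩ := key (q - 1) (by omega) (by omega) (by omega)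
        omega
      · by_contra! hc
        by_cases h' : q = 2 ∨ α ≤ 1 ∨ β ≤ 1
        · by_cases α ≤ β
          · obtain ⟨B, C, h1, h2, h3⟩ := key (β - 1) (by omega) (by omega) (by omega)
            omega
          · obtain ⟨B, C, h1, h2, h3⟩ := key (α - 1) (by omega) (by omega) (by omega)
            omega
        · obtain ⟨B, C, h1, h2, h3⟩ := key 1 (by omega) (by omega) (by omega)
          omega
    · intro hqa
      have := haq hqa
      subst this
      constructor
      · by_contra! hc
        obtain ⟨B, C, h1, h2, h3⟩ := key (α - 1) (by omega) (by omega) (by omega)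
        omega
      · by_contra! hc
        obtain ⟨B, C, h1, h2, h3⟩ := key 1 (by omega) (by omega) (by omega)
        omega
  · rintro ⟨h1, h2⟩ A hA hAa
    have hAl := Nat.mod_lt A (by omega : q > 0)
    have hAq : A < q → A % q = A := Nat.mod_eq_of_lt
    rw [DigitCompatible, sub_mod_eq (by omega), sub_mod_eq (by omega)]
    generalize a % q = α at *
    generalize b % q = β at *
    generalize A % q = x at *
    rcases le_or_gt q a with hqa | hqa
    · have := h1 hqa
      split_ifs <;> omega
    · have := h2 hqa
      have := haq hqa
      have := hAq (by omega)
      split_ifs <;> omega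

theorem twoVarLefschetz_iff {a b : ℕ} (ha : 2 ≤ a) (hab : a ≤ b) :
    TwoVarLefschetz K a b ↔ ∀ e, 1 ≤ e → PrimePowerCondition (p ^ e) a b := by
  have hp : p.Prime := Fact.out
  rw [twoVarLefschetz_iff_digitCompatible (p := p)]
  have hq : ∀ e, 1 ≤ e → 2 ≤ p ^ e := fun e he =>
    hp.two_le.trans (Nat.le_self_pow (by omega) p)
  constructor
  · intro h e he
    rw [← forall_digitCompatible_iff (hq e he) ha hab]
    exact fun A hA hAa => h A hA hAa (by omega) e he
  · intro h A hA hs _ e he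
    exact (forall_digitCompatible_iff (hq e he) ha hab).2 (h e he) A hA hs

end Numeric

/-! ### Cyclic modules over algebras in two variables -/

section Strings

variable {K R : Type*} [Field K] [CommRing R] [Algebra K R]

/-- The entries of `binomMatrix` in the binomial expansion: the terms whose exponent of `z` is less
than `B` or at least `A + B` vanish. -/
theorem add_pow_mul_monomial {A B C : ℕ} {z y a : R} (hz : z ^ (A + B) * a = 0)
    (hy : y ^ (A + C) * a = 0) (u : Fin A) :
    (z + y) ^ (B + C) * (z ^ (u : ℕ) * y ^ (A - 1 - u) * a) =
      ∑ r : Fin A, (((if (u : ℕ) ≤ B + r then (B + C).choose (B + r - u) else 0 : ℕ)) : R) *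
        (z ^ (B + r) * y ^ (C + (A - 1 - r)) * a) := by
  have hu := u.2
  set g : ℕ → R := fun w => (((if (u : ℕ) ≤ w then (B + C).choose (w - u) else 0 : ℕ)) : R) *
    (z ^ w * y ^ (B + C + (A - 1) - w) * a) with hg
  have hz' : ∀ w, A + B ≤ w → z ^ w * a = 0 := fun w hw => by
    rw [← Nat.sub_add_cancel hw, pow_add, mul_assoc, hz, mul_zero]
  have hy' : ∀ w, A + C ≤ w → y ^ w * a = 0 := fun w hw => by
    rw [← Nat.sub_add_cancel hw, pow_add, mul_assoc, hy, mul_zero]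
  have h1 : (z + y) ^ (B + C) * (z ^ (u : ℕ) * y ^ (A - 1 - u) * a) =
      ∑ w ∈ Finset.range (u + (B + C + 1) + (A - 1 - u)), g w := by
    rw [Finset.sum_range_add, Finset.sum_range_add, Finset.sum_eq_zero, zero_add,
      Finset.sum_eq_zero (s := Finset.range (A - 1 - u)), add_zero, add_pow, Finset.sum_mul]
    · refine Finset.sum_congr rfl fun m hm => ?_
      rw [Finset.mem_range] at hm
      simp only [hg]
      rw [if_pos (by omega), Nat.add_sub_cancel_left,
        show B + C + (A - 1) - (u + m) = (B + C - m) + (A - 1 - u) by omega, pow_add, pow_add]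
      ring
    · intro x _
      simp only [hg]
      rw [if_pos (by omega), Nat.choose_eq_zero_of_lt (by omega)]
      simp
    · intro x hx
      rw [Finset.mem_range] at hx
      simp only [hg]
      rw [if_neg (by omega)]
      simp
  have h2 : ∑ w ∈ Finset.range (B + A + C), g w = ∑ r ∈ Finset.range A, g (B + r) := by
    rw [Finset.sum_range_add, Finset.sum_range_add, Finset.sum_eq_zero, zero_add,
      Finset.sum_eq_zero (s := Finset.range C), add_zero]
    · intro x _
      simp only [hg]
      rw [mul_comm (z ^ _), mul_assoc (y ^ _), hz' _ (by omega)]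
      simp
    · intro x hx
      rw [Finset.mem_range] at hx
      simp only [hg]
      rw [mul_assoc (z ^ _), hy' _ (by omega)]
      simp
  rw [h1, show (u : ℕ) + (B + C + 1) + (A - 1 - u) = B + A + C by omega, h2,
    ← Fin.sum_univ_eq_sum_range (fun r => g (B + r))]
  refine Finset.sum_congr rfl fun r _ => ?_
  simp only [hg]
  rw [show B + C + (A - 1) - (B + r) = C + (A - 1 - r) by omega]

theorem add_pow_mul_sum_monomial {A B C : ℕ} {z y a : R} (hz : z ^ (A + B) * a = 0)
    (hy : y ^ (A + C) * a = 0) (c : Fin A → K) :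
    (z + y) ^ (B + C) * ∑ u : Fin A, c u • (z ^ (u : ℕ) * y ^ (A - 1 - u) * a) =
      ∑ r : Fin A, (Matrix.mulVec (binomMatrix K A B C) c) r •
        (z ^ (B + r) * y ^ (C + (A - 1 - r)) * a) := by
  rw [Finset.mul_sum]
  simp only [mul_smul_comm, add_pow_mul_monomial hz hy, Matrix.mulVec, dotProduct,
    Finset.sum_smul, Finset.smul_sum]
  rw [Finset.sum_comm]
  refine Finset.sum_congr rfl fun r _ => Finset.sum_congr rfl fun u _ => ?_
  have h : (binomMatrix K A B C) r u =
      (((if (u : ℕ) ≤ B + r then (B + C).choose (B + r - u) else 0 : ℕ)) : K) := by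
    simp only [binomMatrix, Matrix.of_apply]
    split_ifs <;> simp
  rw [h, mul_comm _ (c u), mul_smul, Nat.cast_smul_eq_nsmul, nsmul_eq_mul]

variable (K) in
/-- The span of the elements `z ^ u * y ^ v * a` with `u + v = i`. -/
def stringSpan (z y a : R) (i : ℕ) : Submodule K R :=
  Submodule.span K {x | ∃ u v : ℕ, u + v = i ∧ x = z ^ u * y ^ v * a}

theorem monomial_mem_stringSpan (z y a : R) {u v i : ℕ} (h : u + v = i) :
    z ^ u * y ^ v * a ∈ stringSpan K z y a i :=
  Submodule.subset_span ⟨u, v, h, rfl⟩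

/-- Beyond the smaller of the two exponents, multiplication by `z + y` is surjective for every
characteristic, by elimination starting from a monomial that vanishes. -/
theorem stringSpan_succ_le {s d k : ℕ} {z y a : R} (hz : z ^ s * a = 0) (hy : y ^ d * a = 0)
    (hk : s ≤ k + 1 ∨ d ≤ k + 1) :
    stringSpan K z y a (k + 1) ≤ (stringSpan K z y a k).map (LinearMap.mulLeft K (z + y)) := by
  set P := (stringSpan K z y a k).map (LinearMap.mulLeft K (z + y)) with hP
  have hgen : ∀ u v, u + v = k → z ^ (u + 1) * y ^ v * a + z ^ u * y ^ (v + 1) * a ∈ P := by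
    intro u v h
    refine ⟨_, monomial_mem_stringSpan z y a h, ?_⟩
    rw [LinearMap.mulLeft_apply]
    ring
  refine Submodule.span_le.2 ?_
  rintro _ ⟨u, v, huv, rfl⟩
  rw [SetLike.mem_coe]
  rcases hk with hk | hk
  · induction v generalizing u with
    | zero =>
      rw [pow_zero, mul_one, ← Nat.sub_add_cancel (show s ≤ u by omega), pow_add, mul_assoc, hz,
        mul_zero]
      exact P.zero_mem
    | succ v ih =>
      exact (P.add_mem_iff_right (ih (u + 1) (by omega))).1 (hgen u v (by omega))
  · induction u generalizing v with
    | zero =>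
      rw [pow_zero, one_mul, ← Nat.sub_add_cancel (show d ≤ v by omega), pow_add, mul_assoc, hy,
        mul_zero]
      exact P.zero_mem
    | succ u ih =>
      exact (P.add_mem_iff_left (ih (v + 1) (by omega))).1 (hgen u v (by omega))

theorem stringSpan_add_le {s d k : ℕ} {z y a : R} (hz : z ^ s * a = 0) (hy : y ^ d * a = 0)
    (hk : s ≤ k + 1 ∨ d ≤ k + 1) (m : ℕ) :
    stringSpan K z y a (k + m) ≤
      (stringSpan K z y a k).map (LinearMap.mulLeft K ((z + y) ^ m)) := by
  induction m with
  | zero =>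
    intro x hx
    exact ⟨x, hx, by simp⟩
  | succ m ih =>
    intro x hx
    obtain ⟨x', hx', rfl⟩ := stringSpan_succ_le (k := k + m) hz hy (by omega) hx
    obtain ⟨x'', hx'', rfl⟩ := ih hx'
    exact ⟨x'', hx'', by simp [pow_succ']⟩

/-- If `K[z, y] / (z ^ s, y ^ d)` has the Lefschetz property with respect to `z + y`, then so
does any cyclic module over it, in the sense of surjectivity. -/
theorem TwoVarLefschetz.stringSpan_le {s d i : ℕ} (h : TwoVarLefschetz K s d) {z y a : R}
    (hz : z ^ s * a = 0) (hy : y ^ d * a = 0) (hs : 1 ≤ s) (hd : 1 ≤ d)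
    (hi : 2 * i ≤ s + d - 2) :
    stringSpan K z y a (s + d - 2 - i) ≤
      (stringSpan K z y a i).map (LinearMap.mulLeft K ((z + y) ^ (s + d - 2 - 2 * i))) := by
  by_cases hmin : s ≤ i + 1 ∨ d ≤ i + 1
  · have := stringSpan_add_le (K := K) hz hy hmin (s + d - 2 - 2 * i)
    rwa [show i + (s + d - 2 - 2 * i) = s + d - 2 - i by omega] at this
  obtain ⟨B, rfl⟩ : ∃ B, s = (i + 1) + B := ⟨s - (i + 1), by omega⟩
  obtain ⟨C, rfl⟩ : ∃ C, d = (i + 1) + C := ⟨d - (i + 1), by omega⟩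
  have hdet := h (i + 1) B C (by omega) (by omega) (by omega) rfl rfl
  refine Submodule.span_le.2 ?_
  rintro _ ⟨u, v, huv, rfl⟩
  rw [SetLike.mem_coe]
  by_cases hu : i + 1 + B ≤ u
  · rw [← Nat.sub_add_cancel hu, pow_add, mul_right_comm, mul_assoc _ _ a, hz]
    simp
  by_cases hv : i + 1 + C ≤ v
  · rw [← Nat.sub_add_cancel hv, pow_add, mul_assoc, mul_assoc _ _ a, hy]
    simp
  -- The coefficients of the preimage form a column of the inverse of `binomMatrix`.
  set r : Fin (i + 1) := ⟨u - B, by omega⟩ with hr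
  set c := Matrix.mulVec (binomMatrix K (i + 1) B C)⁻¹ (Pi.single r 1) with hc
  refine ⟨∑ w : Fin (i + 1), c w • (z ^ (w : ℕ) * y ^ (i + 1 - 1 - w) * a),
    Submodule.sum_mem _ fun w _ => Submodule.smul_mem _ _
      (monomial_mem_stringSpan z y a (by omega)), ?_⟩
  rw [LinearMap.mulLeft_apply, show i + 1 + B + (i + 1 + C) - 2 - 2 * i = B + C by omega,
    add_pow_mul_sum_monomial hz hy, hc, Matrix.mulVec_mulVec,
    Matrix.mul_nonsing_inv _ (Ne.isUnit hdet), Matrix.one_mulVec,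
    Finset.sum_eq_single r]
  · rw [Pi.single_eq_same, one_smul]
    congr 3 <;> simp only [hr] <;> omega
  · intro b _ hb
    rw [Pi.single_eq_of_ne hb, zero_smul]
  · simp

/-- If multiplication by powers of `z + y` is injective on the span of a string, and the
monomials of the string are independent, then `K[z, y] / (z ^ s, y ^ d)` has the Lefschetz
property. -/
theorem twoVarLefschetz_of_injective {s d : ℕ} {z y a : R} (hz : z ^ s * a = 0)
    (hy : y ^ d * a = 0)
    (hinj : ∀ i, 2 * i ≤ s + d - 2 → ∀ x ∈ stringSpan K z y a i,
      (z + y) ^ (s + d - 2 - 2 * i) * x = 0 → x = 0)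
    (hind : ∀ A, A ≤ s → A ≤ d → ∀ c : Fin A → K,
      ∑ u : Fin A, c u • (z ^ (u : ℕ) * y ^ (A - 1 - u) * a) = 0 → c = 0) :
    TwoVarLefschetz K s d := by
  rintro A B C hA hB hC rfl rfl hdet
  obtain ⟨c, hc0, hc⟩ := Matrix.exists_mulVec_eq_zero_iff.2 hdet
  refine hc0 (hind A (by omega) (by omega) c (hinj (A - 1) (by omega) _ ?_ ?_))
  · exact Submodule.sum_mem _ fun u _ => Submodule.smul_mem _ _
      (monomial_mem_stringSpan z y a (by omega))
  · rw [show A + B + (A + C) - 2 - 2 * (A - 1) = B + C by omega,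
      add_pow_mul_sum_monomial hz hy, hc]
    simp

end Strings

/-! ### Monomials and coefficients in a monomial complete intersection -/

namespace MonomialCI

variable {K : Type*} [Field K] {n : ℕ} {d : Fin n → ℕ}

theorem mem_span_X_pow_iff (f : MvPolynomial (Fin n) K) :
    f ∈ Ideal.span (Set.range fun i : Fin n => (X i ^ d i : MvPolynomial (Fin n) K)) ↔
      ∀ m ∈ f.support, ∃ i, d i ≤ m i := by
  have h : (Set.range fun i : Fin n => (X i ^ d i : MvPolynomial (Fin n) K)) =
      (fun s => monomial s (1 : K)) '' Set.range fun i => Finsupp.single i (d i) := by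
    rw [← Set.range_comp]
    congr 1
    ext1 i
    rw [X_pow_eq_monomial]
    rfl
  rw [h, mem_ideal_span_monomial_image]
  simp

variable (K d) in
/-- The coefficient of the monomial `x ^ e` in an element of a monomial complete intersection;
it is zero when `x ^ e` vanishes there. -/
noncomputable def coeffAt (e : Fin n →₀ ℕ) : MonomialCI K d →ₗ[K] K :=
  if h : ∀ i, e i < d i then
    (Submodule.liftQ ((Ideal.span (Set.range fun i : Fin n =>
        (X i ^ d i : MvPolynomial (Fin n) K))).restrictScalars K) (lcoeff K e) (by
      intro f hf
      rw [LinearMap.mem_ker, lcoeff_apply]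
      by_contra hc
      obtain ⟨i, hi⟩ := (mem_span_X_pow_iff f).1 hf e (mem_support_iff.2 hc)
      exact absurd (h i) (not_lt.2 hi))) ∘ₗ
      (Submodule.Quotient.restrictScalarsEquiv K _).symm.toLinearMap
  else 0

theorem coeffAt_mk {e : Fin n →₀ ℕ} (he : ∀ i, e i < d i) (f : MvPolynomial (Fin n) K) :
    coeffAt K d e (Ideal.Quotient.mk _ f) = coeff e f := by
  rw [coeffAt, dif_pos he]
  rfl

theorem coeffAt_of_not {e : Fin n →₀ ℕ} (he : ¬ ∀ i, e i < d i) : coeffAt K d e = 0 := by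
  rw [coeffAt, dif_neg he]

theorem lt_of_coeffAt_ne_zero {e : Fin n →₀ ℕ} {b : MonomialCI K d} (h : coeffAt K d e b ≠ 0) :
    ∀ i, e i < d i := by
  by_contra he
  rw [coeffAt_of_not he] at h
  exact h rfl

theorem eq_zero_of_coeffAt {b : MonomialCI K d} (h : ∀ e, coeffAt K d e b = 0) : b = 0 := by
  obtain ⟨f, rfl⟩ := Ideal.Quotient.mk_surjective b
  rw [Ideal.Quotient.eq_zero_iff_mem, mem_span_X_pow_iff]
  intro m hm
  by_contra! hc
  have := h m
  rw [coeffAt_mk hc] at this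
  exact mem_support_iff.1 hm this

variable (K d) in
/-- The class of a variable in a monomial complete intersection. -/
noncomputable def gen (j : Fin n) : MonomialCI K d := Ideal.Quotient.mk _ (X j)

variable (K d) in
/-- The class of a monomial in a monomial complete intersection. -/
noncomputable def mon (e : Fin n →₀ ℕ) : MonomialCI K d := Ideal.Quotient.mk _ (monomial e 1)

theorem gen_pow (j : Fin n) : gen K d j ^ d j = 0 := by
  rw [gen, ← map_pow, Ideal.Quotient.eq_zero_iff_mem]
  exact Ideal.subset_span ⟨j, rfl⟩

theorem coeffAt_gen_mul_of_eq_zero {e : Fin n →₀ ℕ} {j : Fin n} (h : e j = 0)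
    (b : MonomialCI K d) : coeffAt K d e (gen K d j * b) = 0 := by
  by_cases he : ∀ i, e i < d i
  · obtain ⟨f, rfl⟩ := Ideal.Quotient.mk_surjective b
    rw [gen, ← map_mul, coeffAt_mk he, coeff_X_mul', if_neg]
    simpa using h
  · rw [coeffAt_of_not he, LinearMap.zero_apply]

theorem coeffAt_add_single_gen_mul {e : Fin n →₀ ℕ} {j : Fin n} (h : e j + 1 < d j)
    (b : MonomialCI K d) :
    coeffAt K d (e + Finsupp.single j 1) (gen K d j * b) = coeffAt K d e b := by
  by_cases he : ∀ i, e i < d i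
  · have he' : ∀ i, (e + Finsupp.single j 1 : Fin n →₀ ℕ) i < d i := by
      intro i
      rcases eq_or_ne i j with rfl | hi
      · simpa using h
      · simpa [Finsupp.single_eq_of_ne hi] using he i
    obtain ⟨f, rfl⟩ := Ideal.Quotient.mk_surjective b
    rw [gen, ← map_mul, coeffAt_mk he', coeffAt_mk he, add_comm, coeff_X_mul]
  · rw [coeffAt_of_not he, coeffAt_of_not, LinearMap.zero_apply, LinearMap.zero_apply]
    intro h'
    exact he fun i => lt_of_le_of_lt (by simp) (h' i)

theorem coeffAt_mon {e e' : Fin n →₀ ℕ} (he : ∀ i, e i < d i) :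
    coeffAt K d e (mon K d e') = if e' = e then 1 else 0 := by
  classical
  rw [mon, coeffAt_mk he, coeff_monomial]

theorem mon_eq_gen_pow_mul (e : Fin n →₀ ℕ) (j : Fin n) :
    mon K d e = gen K d j ^ e j * mon K d (e.erase j) := by
  rw [mon, mon, gen, ← map_pow, ← map_mul, X_pow_eq_monomial, monomial_mul, one_mul,
    Finsupp.single_add_erase]

variable (d) in
/-- The exponent of the monomial of largest degree in the variables indexed by `T`. -/
noncomputable def topExp (T : Finset (Fin n)) : Fin n →₀ ℕ :=
  ∑ j ∈ T, Finsupp.single j (d j - 1)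

variable (d) in
/-- The largest degree of a monomial in the variables indexed by `T`. -/
def topDeg (T : Finset (Fin n)) : ℕ := ∑ j ∈ T, (d j - 1)

theorem topExp_apply (T : Finset (Fin n)) (j : Fin n) :
    topExp d T j = if j ∈ T then d j - 1 else 0 := by
  rw [topExp, Finsupp.finsetSum_apply]
  simp only [Finsupp.single_apply, Finset.sum_ite_eq']

theorem degree_topExp (T : Finset (Fin n)) : (topExp d T).degree = topDeg d T := by
  rw [topExp, map_sum]
  simp only [topDeg, Finsupp.degree_single]

theorem le_topExp_iff {T : Finset (Fin n)} {e : Fin n →₀ ℕ} :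
    e ≤ topExp d T ↔ ∀ j, (j ∈ T → e j ≤ d j - 1) ∧ (j ∉ T → e j = 0) := by
  rw [Finsupp.le_def]
  refine forall_congr' fun j => ?_
  rw [topExp_apply]
  split_ifs with h <;> simp [h]

theorem topExp_mono {S T : Finset (Fin n)} (h : S ⊆ T) : topExp d S ≤ topExp d T := by
  rw [le_topExp_iff]
  intro j
  rw [topExp_apply]
  split_ifs with hj
  · exact ⟨fun _ => le_rfl, fun h' => absurd (h hj) h'⟩
  · simp

theorem topDeg_insert {T : Finset (Fin n)} {j : Fin n} (hj : j ∉ T) :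
    topDeg d (insert j T) = d j - 1 + topDeg d T :=
  Finset.sum_insert hj

theorem lt_of_le_topExp (hd : ∀ i, 1 ≤ d i) {T : Finset (Fin n)} {e : Fin n →₀ ℕ}
    (h : e ≤ topExp d T) : ∀ i, e i < d i := by
  intro i
  have h1 := le_topExp_iff.1 h i
  have := hd i
  by_cases hi : i ∈ T
  · have := h1.1 hi; omega
  · have := h1.2 hi; omega

variable (K d) in
/-- The part of degree `i` of the subalgebra generated by the variables indexed by `T`, described
by the coefficients that may be nonzero. -/
noncomputable def subPart (T : Finset (Fin n)) (i : ℕ) : Submodule K (MonomialCI K d) where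
  carrier := {b | ∀ e, coeffAt K d e b ≠ 0 → e ≤ topExp d T ∧ e.degree = i}
  zero_mem' := by simp
  add_mem' := by
    intro a b ha hb e he
    by_cases h : coeffAt K d e a = 0
    · refine hb e fun h' => he ?_
      rw [map_add, h, h', add_zero]
    · exact ha e h
  smul_mem' := by
    intro c b hb e he
    refine hb e fun h => he ?_
    rw [map_smul, h, smul_zero]

theorem subPart_mono {S T : Finset (Fin n)} (h : S ⊆ T) (i : ℕ) :
    subPart K d S i ≤ subPart K d T i :=
  fun _ hb e he => ⟨(hb e he).1.trans (topExp_mono h), (hb e he).2⟩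

theorem eq_zero_of_mem_subPart {T : Finset (Fin n)} {i : ℕ} (hi : topDeg d T < i)
    {b : MonomialCI K d} (hb : b ∈ subPart K d T i) : b = 0 := by
  refine eq_zero_of_coeffAt fun e => ?_
  by_contra he
  obtain ⟨h1, h2⟩ := hb e he
  have := Finsupp.degree_mono h1
  rw [degree_topExp] at this
  omega

theorem mon_mem_subPart {T : Finset (Fin n)} {e : Fin n →₀ ℕ} (he : e ≤ topExp d T) :
    mon K d e ∈ subPart K d T e.degree := by
  intro e' he'
  rw [coeffAt_mon (lt_of_coeffAt_ne_zero he')] at he'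
  have : e = e' := by
    by_contra h
    exact he' (if_neg h)
  exact this ▸ ⟨he, rfl⟩

theorem gen_mul_mem_subPart {T : Finset (Fin n)} {i : ℕ} {j : Fin n} (hj : j ∈ T)
    {b : MonomialCI K d} (hb : b ∈ subPart K d T i) : gen K d j * b ∈ subPart K d T (i + 1) := by
  intro e he
  have hlt := lt_of_coeffAt_ne_zero he
  have h0 : e j ≠ 0 := fun h => he (coeffAt_gen_mul_of_eq_zero h b)
  obtain ⟨e', rfl⟩ : ∃ e', e = e' + Finsupp.single j 1 :=
    ⟨e - Finsupp.single j 1, (tsub_add_cancel_of_le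
      (Finsupp.single_le_iff.2 (Nat.one_le_iff_ne_zero.2 h0))).symm⟩
  have hjlt : e' j + 1 < d j := by simpa using hlt j
  rw [coeffAt_add_single_gen_mul hjlt] at he
  obtain ⟨h1, h2⟩ := hb e' he
  refine ⟨?_, by rw [map_add, h2, Finsupp.degree_single]⟩
  rw [le_topExp_iff] at h1 ⊢
  intro k
  rcases eq_or_ne k j with rfl | hk
  · simp only [Finsupp.add_apply, Finsupp.single_eq_same]
    exact ⟨fun _ => by omega, fun h => absurd hj h⟩
  · simpa [Finsupp.single_eq_of_ne hk] using h1 k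

theorem gen_pow_mul_mem_subPart {T : Finset (Fin n)} {i : ℕ} {j : Fin n} (hj : j ∈ T) (v : ℕ)
    {b : MonomialCI K d} (hb : b ∈ subPart K d T i) :
    gen K d j ^ v * b ∈ subPart K d T (i + v) := by
  induction v with
  | zero => simpa using hb
  | succ v ih =>
    rw [pow_succ', mul_assoc]
    exact gen_mul_mem_subPart hj ih

theorem eq_sum_coeffAt_smul_mon (b : MonomialCI K d) :
    b = ∑ e ∈ Finset.Iic (topExp d Finset.univ), coeffAt K d e b • mon K d e := by
  rw [← sub_eq_zero]
  refine eq_zero_of_coeffAt fun e => ?_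
  by_cases he : ∀ i, e i < d i
  · rw [map_sub, map_sum, Finset.sum_eq_single e]
    · rw [map_smul, coeffAt_mon he, if_pos rfl, smul_eq_mul, mul_one, sub_self]
    · intro e' _ hne
      rw [map_smul, coeffAt_mon he, if_neg hne, smul_zero]
    · intro h
      refine absurd (Finset.mem_Iic.2 (le_topExp_iff.2 fun j => ⟨fun _ => ?_, by simp⟩)) h
      have := he j
      omega
  · rw [coeffAt_of_not he, LinearMap.zero_apply]

/-- To show that a submodule contains the part `subPart K d T i`, it suffices to show that it
contains its monomials. -/
theorem subPart_le {T : Finset (Fin n)} {i : ℕ}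
    {P : Submodule K (MonomialCI K d)}
    (h : ∀ e, e ≤ topExp d T → e.degree = i → mon K d e ∈ P) : subPart K d T i ≤ P := by
  intro b hb
  rw [eq_sum_coeffAt_smul_mon b]
  refine Submodule.sum_mem _ fun e _ => ?_
  by_cases he : coeffAt K d e b = 0
  · rw [he, zero_smul]
    exact P.zero_mem
  · exact P.smul_mem _ (h e (hb e he).1 (hb e he).2)

/-- To show that a submodule contains the part `subPart K d (insert j T) i`, it suffices to
consider products of powers of the variable `j` and elements in the variables of `T`. -/
theorem subPart_insert_le {T : Finset (Fin n)} {j : Fin n} {i : ℕ}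
    (hj : j ∉ T) {P : Submodule K (MonomialCI K d)}
    (h : ∀ v w, v + w = i → ∀ a ∈ subPart K d T w, gen K d j ^ v * a ∈ P) :
    subPart K d (insert j T) i ≤ P := by
  refine subPart_le fun e he hi => ?_
  rw [mon_eq_gen_pow_mul e j]
  refine h (e j) (e.erase j).degree ?_ _ (mon_mem_subPart ?_)
  · rw [← hi, ← Finsupp.degree_single j (e j), ← map_add, Finsupp.single_add_erase]
  · rw [le_topExp_iff] at he ⊢
    intro k
    rcases eq_or_ne k j with rfl | hk
    · simp [hj]
    · rw [Finsupp.erase_ne hk]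
      simpa [hk] using he k

/-- The expansion of an element in powers of a variable is unique. -/
theorem eq_zero_of_sum_gen_pow_mul {T : Finset (Fin n)} {j : Fin n} (hj : j ∉ T) {m : ℕ}
    (hm : m ≤ d j) (a : ℕ → MonomialCI K d) (ha : ∀ v, ∃ i, a v ∈ subPart K d T i)
    (h : ∑ v ∈ Finset.range m, gen K d j ^ v * a v = 0) : ∀ v < m, a v = 0 := by
  have hpow : ∀ (v : ℕ) (b : MonomialCI K d) (e : Fin n →₀ ℕ), e j + v < d j →
      coeffAt K d (e + Finsupp.single j v) (gen K d j ^ v * b) = coeffAt K d e b := by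
    intro v b e hv
    induction v with
    | zero => simp
    | succ v ih =>
      rw [pow_succ', mul_assoc, Finsupp.single_add, ← add_assoc, coeffAt_add_single_gen_mul,
        ih (by omega)]
      simp only [Finsupp.add_apply, Finsupp.single_eq_same]
      omega
  have hpow' : ∀ (v : ℕ) (b : MonomialCI K d) (e : Fin n →₀ ℕ), e j < v →
      coeffAt K d e (gen K d j ^ v * b) = 0 := by
    intro v
    induction v with
    | zero => intro b e hv; omega
    | succ v ih =>
      intro b e hv
      by_cases hlt : ∀ i, e i < d i
      · by_cases h0 : e j = 0
        · rw [pow_succ', mul_assoc, coeffAt_gen_mul_of_eq_zero h0]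
        · have hlt := hlt j
          obtain ⟨e', rfl⟩ : ∃ e', e = e' + Finsupp.single j 1 :=
            ⟨e - Finsupp.single j 1, (tsub_add_cancel_of_le
              (Finsupp.single_le_iff.2 (Nat.one_le_iff_ne_zero.2 h0))).symm⟩
          simp only [Finsupp.add_apply, Finsupp.single_eq_same] at hv hlt
          rw [pow_succ', mul_assoc, coeffAt_add_single_gen_mul hlt, ih _ _ (by omega)]
      · rw [coeffAt_of_not hlt, LinearMap.zero_apply]
  intro v hv
  refine eq_zero_of_coeffAt fun e => ?_
  by_contra he
  obtain ⟨i, hi⟩ := ha v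
  have hej : e j = 0 := (le_topExp_iff.1 (hi e he).1 j).2 hj
  have h' := congrArg (coeffAt K d (e + Finsupp.single j v)) h
  rw [map_sum, map_zero, Finset.sum_eq_single v, hpow v _ e (by omega)] at h'
  · exact he h'
  · intro w _ hwv
    rcases lt_or_gt_of_ne hwv with hlt | hgt
    · obtain ⟨k, rfl⟩ := Nat.exists_eq_add_of_lt hlt
      rw [show w + k + 1 = (k + 1) + w by ring, Finsupp.single_add, ← add_assoc, hpow]
      · by_contra hne
        obtain ⟨i', hi'⟩ := ha w
        have := (le_topExp_iff.1 (hi' _ hne).1 j).2 hj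
        simp at this
      · simp only [Finsupp.add_apply, Finsupp.single_eq_same]
        omega
    · refine hpow' _ _ _ ?_
      simp only [Finsupp.add_apply, Finsupp.single_eq_same]
      omega
  · intro hv'
    exact absurd (Finset.mem_range.2 hv) hv'

variable (d) in
/-- The exponents of the monomials that form a basis of `subPart K d T i`. -/
noncomputable def expFinset (T : Finset (Fin n)) (i : ℕ) : Finset (Fin n →₀ ℕ) :=
  (Finset.Iic (topExp d T)).filter fun e => e.degree = i

theorem mem_expFinset {T : Finset (Fin n)} {i : ℕ} {e : Fin n →₀ ℕ} :
    e ∈ expFinset d T i ↔ e ≤ topExp d T ∧ e.degree = i := by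
  rw [expFinset, Finset.mem_filter, Finset.mem_Iic]

/-- The coordinates of an element of `subPart K d T i` in the monomial basis. -/
noncomputable def subPartEquiv (hd : ∀ i, 1 ≤ d i) (T : Finset (Fin n)) (i : ℕ) :
    subPart K d T i ≃ₗ[K] (expFinset d T i → K) :=
  LinearEquiv.ofBijective
    (LinearMap.pi fun e : expFinset d T i => coeffAt K d e.1 ∘ₗ (subPart K d T i).subtype) (by
    constructor
    · rw [← LinearMap.ker_eq_bot, LinearMap.ker_eq_bot']
      rintro ⟨b, hb⟩ h
      refine Subtype.ext (eq_zero_of_coeffAt fun e => ?_)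
      by_contra he
      exact he (congrFun h ⟨e, mem_expFinset.2 (hb e he)⟩)
    · intro f
      refine ⟨⟨∑ e : expFinset d T i, f e • mon K d e.1, Submodule.sum_mem _ fun e _ =>
        Submodule.smul_mem _ _ ?_⟩, ?_⟩
      · have h := mem_expFinset.1 e.2
        have h' := mon_mem_subPart (K := K) h.1
        rwa [h.2] at h'
      · ext e
        have hlt := lt_of_le_topExp hd (mem_expFinset.1 e.2).1
        rw [LinearMap.pi_apply, LinearMap.comp_apply, Submodule.subtype_apply, map_sum,
          Finset.sum_eq_single e]
        · rw [map_smul, coeffAt_mon hlt, if_pos rfl, smul_eq_mul, mul_one]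
        · intro e' _ hne
          rw [map_smul, coeffAt_mon hlt, if_neg (fun h => hne (Subtype.ext h)), smul_zero]
        · simp)

theorem finrank_subPart (hd : ∀ i, 1 ≤ d i) (T : Finset (Fin n)) (i : ℕ) :
    Module.finrank K (subPart K d T i) = (expFinset d T i).card := by
  rw [(subPartEquiv hd T i).finrank_eq, Module.finrank_fintype_fun_eq_card, Fintype.card_coe]

theorem finiteDimensional_subPart (hd : ∀ i, 1 ≤ d i) (T : Finset (Fin n)) (i : ℕ) :
    FiniteDimensional K (subPart K d T i) :=
  Module.Finite.equiv (subPartEquiv hd T i).symm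

/-- The Hilbert function is symmetric. -/
theorem finrank_subPart_symm (hd : ∀ i, 1 ≤ d i) {T : Finset (Fin n)} {i k : ℕ}
    (h : i + k = topDeg d T) :
    Module.finrank K (subPart K d T i) = Module.finrank K (subPart K d T k) := by
  rw [finrank_subPart hd, finrank_subPart hd]
  have key : ∀ {i k : ℕ}, i + k = topDeg d T → ∀ e ∈ expFinset d T i,
      topExp d T - e ∈ expFinset d T k := by
    intro i k h e he
    rw [mem_expFinset] at he ⊢
    have h1 : (topExp d T - e).degree + e.degree = topDeg d T := by
      rw [← map_add, tsub_add_cancel_of_le he.1, degree_topExp]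
    exact ⟨tsub_le_self, by omega⟩
  -- Complementing exponents exchanges the monomials of degrees `i` and `k`.
  refine Finset.card_nbij' (fun e => topExp d T - e) (fun e => topExp d T - e) (key h)
    (key (by omega)) ?_ ?_ <;>
  · intro e he
    exact tsub_tsub_cancel_of_le (mem_expFinset.1 he).1

end MonomialCI

/-! ### The Lefschetz property for a subset of the variables -/

namespace MonomialCI

variable {K : Type*} [Field K] {n : ℕ} {d : Fin n → ℕ}

variable (d) in
/-- The linear form with coefficients `c` in the variables indexed by `T`. -/
noncomputable def linForm (c : Fin n → K) (T : Finset (Fin n)) : MonomialCI K d :=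
  ∑ j ∈ T, c j • gen K d j

variable (d) in
/-- The strong Lefschetz property, in the narrow sense and with respect to the linear form with
coefficients `c`, of the subalgebra generated by the variables indexed by `T`. -/
def LefschetzOn (c : Fin n → K) (T : Finset (Fin n)) : Prop :=
  ∀ i, 2 * i ≤ topDeg d T → ∀ a ∈ subPart K d T i,
    linForm d c T ^ (topDeg d T - 2 * i) * a = 0 → a = 0

variable {c : Fin n → K} {T : Finset (Fin n)} {j : Fin n}

theorem linForm_insert (hj : j ∉ T) :
    linForm d c (insert j T) = linForm d c T + c j • gen K d j := by
  rw [linForm, Finset.sum_insert hj, add_comm, linForm]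

theorem linForm_pow_mul_mem_subPart {i : ℕ} {b : MonomialCI K d} (hb : b ∈ subPart K d T i)
    (m : ℕ) : linForm d c T ^ m * b ∈ subPart K d T (i + m) := by
  induction m with
  | zero => simpa using hb
  | succ m ih =>
    rw [pow_succ', mul_assoc, linForm, Finset.sum_mul]
    refine Submodule.sum_mem _ fun j hj => ?_
    rw [smul_mul_assoc]
    exact Submodule.smul_mem _ _ (gen_mul_mem_subPart hj ih)

/-- In symmetric degrees the dimensions agree, so injectivity and surjectivity are equivalent. -/
theorem linForm_pow_injective_iff_surjective (hd : ∀ i, 1 ≤ d i) {i m : ℕ}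
    (h : 2 * i + m = topDeg d T) :
    (∀ a ∈ subPart K d T i, linForm d c T ^ m * a = 0 → a = 0) ↔
      subPart K d T (i + m) ≤
        (subPart K d T i).map (LinearMap.mulLeft K (linForm d c T ^ m)) := by
  have := finiteDimensional_subPart (K := K) hd T i
  have := finiteDimensional_subPart (K := K) hd T (i + m)
  let f : subPart K d T i →ₗ[K] subPart K d T (i + m) :=
    (LinearMap.mulLeft K (linForm d c T ^ m)).restrict
      fun b hb => linForm_pow_mul_mem_subPart hb m
  have hf : ∀ a, ((f a : subPart K d T (i + m)) : MonomialCI K d) = linForm d c T ^ m * a :=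
    fun a => rfl
  have h1 : (∀ a ∈ subPart K d T i, linForm d c T ^ m * a = 0 → a = 0) ↔
      Function.Injective f := by
    rw [← LinearMap.ker_eq_bot, LinearMap.ker_eq_bot']
    constructor
    · rintro H ⟨a, ha⟩ hfa
      exact Subtype.ext (H a ha (congrArg Subtype.val hfa))
    · intro H a ha hfa
      exact congrArg Subtype.val (H ⟨a, ha⟩ (Subtype.ext hfa))
  have h2 : subPart K d T (i + m) ≤
      (subPart K d T i).map (LinearMap.mulLeft K (linForm d c T ^ m)) ↔
      Function.Surjective f := by
    constructor
    · rintro H ⟨b, hb⟩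
      obtain ⟨a, ha, hab⟩ := H hb
      exact ⟨⟨a, ha⟩, Subtype.ext hab⟩
    · intro H b hb
      obtain ⟨a, hab⟩ := H ⟨b, hb⟩
      exact ⟨a, a.2, congrArg Subtype.val hab⟩
  rw [h1, h2]
  exact LinearMap.injective_iff_surjective_of_finrank_eq_finrank
    (finrank_subPart_symm hd (by omega))

theorem lefschetzOn_iff_surjective (hd : ∀ i, 1 ≤ d i) :
    LefschetzOn d c T ↔ ∀ i m, 2 * i + m = topDeg d T → subPart K d T (i + m) ≤
      (subPart K d T i).map (LinearMap.mulLeft K (linForm d c T ^ m)) := by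
  constructor
  · intro H i m h
    rw [← linForm_pow_injective_iff_surjective hd h]
    have := H i (by omega)
    rwa [show topDeg d T - 2 * i = m by omega] at this
  · intro H i hi
    exact (linForm_pow_injective_iff_surjective hd (by omega)).2 (H i _ (by omega))

theorem lefschetzOn_empty : LefschetzOn d c ∅ := by
  intro i hi a _ h
  simpa [topDeg] using h

/-- The strong Lefschetz property passes to fewer variables: a power of `ℓ + y` that annihilates
`a` can be produced from a power of `ℓ` that does and the fact that `y` is nilpotent. -/
theorem LefschetzOn.of_insert (hd : ∀ i, 1 ≤ d i) (hj : j ∉ T)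
    (H : LefschetzOn d c (insert j T)) : LefschetzOn d c T := by
  intro i hi a ha h
  have hdj := hd j
  refine H i (by rw [topDeg_insert hj]; omega) a (subPart_mono (Finset.subset_insert _ _) _ ha) ?_
  rw [linForm_insert hj, topDeg_insert hj, add_pow, Finset.sum_mul]
  refine Finset.sum_eq_zero fun m hm => ?_
  rw [Finset.mem_range] at hm
  by_cases hm' : topDeg d T - 2 * i ≤ m
  · have h0 : linForm d c T ^ m * a = 0 := by
      rw [← Nat.sub_add_cancel hm', pow_add, mul_assoc, h, mul_zero]
    rw [mul_right_comm, mul_right_comm (linForm d c T ^ m), h0, zero_mul, zero_mul]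
  · have h0 : (c j • gen K d j) ^ (d j - 1 + topDeg d T - 2 * i - m) = 0 := by
      rw [show d j - 1 + topDeg d T - 2 * i - m =
        (d j - 1 + topDeg d T - 2 * i - m - d j) + d j by omega, pow_add, smul_pow _ _ (d j),
        gen_pow, smul_zero, mul_zero]
    rw [h0]
    ring

theorem LefschetzOn.mono (hd : ∀ i, 1 ≤ d i) {S : Finset (Fin n)} (hST : S ⊆ T)
    (H : LefschetzOn d c T) : LefschetzOn d c S := by
  have key : ∀ U : Finset (Fin n), LefschetzOn d c (U ∪ S) → LefschetzOn d c S := by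
    intro U
    induction U using Finset.induction_on with
    | empty => simp
    | insert j U _ ih =>
      rw [Finset.insert_union]
      by_cases hj : j ∈ U ∪ S
      · rwa [Finset.insert_eq_of_mem hj]
      · exact fun h => ih (h.of_insert hd hj)
  exact key T (by rwa [Finset.union_eq_left.2 hST])

theorem stringSpan_le_subPart {i : ℕ} {a : MonomialCI K d}
    (ha : a ∈ subPart K d T i) (k : ℕ) :
    stringSpan K (linForm d c T) (c j • gen K d j) a k ≤ subPart K d (insert j T) (i + k) := by
  refine Submodule.span_le.2 ?_
  rintro _ ⟨u, v, rfl, rfl⟩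
  have h1 : linForm d c T ^ u * (c j • gen K d j) ^ v * a =
      c j ^ v • (gen K d j ^ v * (linForm d c T ^ u * a)) := by
    rw [smul_pow, mul_smul_comm, smul_mul_assoc]
    ring_nf
  rw [SetLike.mem_coe, h1, ← add_assoc]
  exact Submodule.smul_mem _ _ (gen_pow_mul_mem_subPart (Finset.mem_insert_self _ _) _
    (subPart_mono (Finset.subset_insert _ _) _ (linForm_pow_mul_mem_subPart ha u)))

theorem smul_gen_pow_mul (a : MonomialCI K d) : (c j • gen K d j) ^ d j * a = 0 := by
  rw [smul_pow, gen_pow, smul_zero, zero_mul]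

/-- A primitive element of degree `i` spans a copy of `K[z] / (z ^ s)` centred in the middle
degree, where `s = topDeg d T - 2 * i + 1`, so that adjoining another variable embeds the
corresponding algebra in two variables. -/
theorem LefschetzOn.twoVarLefschetz (hd : ∀ i, 1 ≤ d i) (hj : j ∉ T) (hc : c j ≠ 0)
    (H : LefschetzOn d c (insert j T)) {i : ℕ} (hi : 2 * i ≤ topDeg d T) {a : MonomialCI K d}
    (ha : a ∈ subPart K d T i) (ha0 : a ≠ 0)
    (hprim : linForm d c T ^ (topDeg d T - 2 * i + 1) * a = 0) :
    TwoVarLefschetz K (topDeg d T - 2 * i + 1) (d j) := by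
  have hdj := hd j
  refine twoVarLefschetz_of_injective hprim (smul_gen_pow_mul (c := c) a) ?_ ?_
  · intro k hk x hx h
    rw [← linForm_insert hj] at h
    refine H (i + k) ?_ x (stringSpan_le_subPart ha k hx) ?_
    · rw [topDeg_insert hj]; omega
    · rw [topDeg_insert hj]
      rwa [show d j - 1 + topDeg d T - 2 * (i + k) =
        topDeg d T - 2 * i + 1 + d j - 2 - 2 * k by omega]
  · intro A hAs hAd c' hsum
    have hne : ∀ u < A, linForm d c T ^ u * a ≠ 0 := by
      intro u hu h0
      refine ha0 (H.of_insert hd hj i hi a ha ?_)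
      rw [← Nat.sub_add_cancel (show u ≤ topDeg d T - 2 * i by omega), pow_add, mul_assoc, h0,
        mul_zero]
    set c'' : ℕ → K := fun u => if h : u < A then c' ⟨u, h⟩ else 0 with hc''
    have hc' : ∀ u : Fin A, c' u = c'' u := fun u => by rw [hc'']; simp
    have hsum' : ∑ v ∈ Finset.range A, gen K d j ^ v *
        ((c'' (A - 1 - v) * c j ^ v) • (linForm d c T ^ (A - 1 - v) * a)) = 0 := by
      rw [← Finset.sum_range_reflect, ← hsum]
      simp only [hc']
      rw [Fin.sum_univ_eq_sum_range (fun u => c'' u •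
        (linForm d c T ^ u * (c j • gen K d j) ^ (A - 1 - u) * a))]
      refine Finset.sum_congr rfl fun u hu => ?_
      rw [Finset.mem_range] at hu
      rw [show A - 1 - (A - 1 - u) = u by omega, mul_smul_comm, mul_smul, smul_pow,
        mul_smul_comm, smul_mul_assoc]
      ring_nf
    have hz := eq_zero_of_sum_gen_pow_mul hj hAd _
      (fun v => ⟨_, Submodule.smul_mem _ _ (linForm_pow_mul_mem_subPart ha _)⟩) hsum'
    funext u
    have hu := u.2
    have := hz (A - 1 - u) (by omega)
    rw [show A - 1 - (A - 1 - u) = u by omega] at this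
    rw [hc', Pi.zero_apply]
    exact (mul_eq_zero.1 ((smul_eq_zero.1 this).resolve_right (hne _ hu))).resolve_right
      (pow_ne_zero _ hc)

/-- The primitive decomposition: under the strong Lefschetz property, every element is a sum of
elements `ℓ ^ u * a` with `a` primitive. -/
theorem LefschetzOn.subPart_le (hd : ∀ i, 1 ≤ d i) (H : LefschetzOn d c T) {k : ℕ}
    {P : Submodule K (MonomialCI K d)}
    (h : ∀ i u, i + u = k → 2 * i ≤ topDeg d T → ∀ a ∈ subPart K d T i,
      linForm d c T ^ (topDeg d T - 2 * i + 1) * a = 0 → linForm d c T ^ u * a ∈ P) :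
    subPart K d T k ≤ P := by
  rw [lefschetzOn_iff_surjective hd] at H
  have low : ∀ k, 2 * k ≤ topDeg d T → ∀ P : Submodule K (MonomialCI K d),
      (∀ i u, i + u = k → 2 * i ≤ topDeg d T → ∀ a ∈ subPart K d T i,
        linForm d c T ^ (topDeg d T - 2 * i + 1) * a = 0 → linForm d c T ^ u * a ∈ P) →
      subPart K d T k ≤ P := by
    intro k
    induction k with
    | zero =>
      intro _ P h a ha
      have := h 0 0 rfl (by omega) a ha (eq_zero_of_mem_subPart (T := T)
        (i := 0 + (topDeg d T - 2 * 0 + 1)) (by omega) (linForm_pow_mul_mem_subPart ha _))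
      simpa using this
    | succ k ih =>
      intro hk P h b hb
      -- Surjectivity in degree `k` gives `w` such that `b - ℓ * w` is primitive.
      have hmem := linForm_pow_mul_mem_subPart (c := c) hb (topDeg d T - 2 * (k + 1) + 1)
      rw [show k + 1 + (topDeg d T - 2 * (k + 1) + 1) = k + (topDeg d T - 2 * k) by omega] at hmem
      obtain ⟨w, hw, hwb⟩ := H k _ (by omega) hmem
      rw [LinearMap.mulLeft_apply, show topDeg d T - 2 * k =
        topDeg d T - 2 * (k + 1) + 1 + 1 by omega] at hwb
      have hw1 : linForm d c T * w ∈ P := by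
        refine ih (by omega) (P.comap (LinearMap.mulLeft K (linForm d c T))) ?_ hw
        intro i u hiu hi a ha hprim
        have := h i (u + 1) (by omega) hi a ha hprim
        rwa [pow_succ', mul_assoc] at this
      have hw2 : linForm d c T * w ∈ subPart K d T (k + 1) := by
        simpa using linForm_pow_mul_mem_subPart (c := c) hw 1
      have hdiff := h (k + 1) 0 rfl hk (b - linForm d c T * w) (Submodule.sub_mem _ hb hw2) (by
        rw [mul_sub, ← mul_assoc, ← pow_succ, hwb, sub_self])
      rw [pow_zero, one_mul] at hdiff
      exact (P.sub_mem_iff_left hw1).1 hdiff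
  by_cases hk : 2 * k ≤ topDeg d T
  · exact low k hk P h
  by_cases hk' : topDeg d T < k
  · intro b hb
    rw [eq_zero_of_mem_subPart hk' hb]
    exact P.zero_mem
  have hle := H (topDeg d T - k) (2 * k - topDeg d T) (by omega)
  rw [show topDeg d T - k + (2 * k - topDeg d T) = k by omega] at hle
  refine hle.trans (Submodule.map_le_iff_le_comap.2 (low _ (by omega) _ ?_))
  intro i u hiu hi a ha hprim
  have := h i (2 * k - topDeg d T + u) (by omega) hi a ha hprim
  rwa [pow_add, mul_assoc] at this

/-- The converse of `LefschetzOn.twoVarLefschetz`: by the primitive decomposition, adjoining a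
variable gives a sum of cyclic modules over algebras in two variables, all centred in the same
degree. -/
theorem LefschetzOn.insert (hd : ∀ i, 1 ≤ d i) (hj : j ∉ T) (H : LefschetzOn d c T)
    (hc : c j ≠ 0)
    (htwo : ∀ i, 2 * i ≤ topDeg d T → (∃ a ∈ subPart K d T i, a ≠ 0 ∧
      linForm d c T ^ (topDeg d T - 2 * i + 1) * a = 0) →
      TwoVarLefschetz K (topDeg d T - 2 * i + 1) (d j)) :
    LefschetzOn d c (insert j T) := by
  have hdj := hd j
  rw [lefschetzOn_iff_surjective hd]
  intro i m him
  rw [topDeg_insert hj] at him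
  set P := (subPart K d (Insert.insert j T) i).map
    (LinearMap.mulLeft K (linForm d c (Insert.insert j T) ^ m)) with hP
  refine subPart_insert_le hj fun v w hvw b hb => ?_
  have hle : subPart K d T w ≤ P.comap (LinearMap.mulLeft K (gen K d j ^ v)) := by
    refine H.subPart_le hd ?_
    intro k u hku hk a ha hprim
    rw [Submodule.mem_comap, LinearMap.mulLeft_apply]
    rcases eq_or_ne a 0 with rfl | ha0
    · simp
    have htw := htwo k hk ⟨a, ha, ha0, hprim⟩
    set s := topDeg d T - 2 * k + 1 with hs
    have hmono : linForm d c T ^ u * (c j • gen K d j) ^ v * a =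
        c j ^ v • (gen K d j ^ v * (linForm d c T ^ u * a)) := by
      rw [smul_pow, mul_smul_comm, smul_mul_assoc]
      ring_nf
    have hmem : linForm d c T ^ u * (c j • gen K d j) ^ v * a ∈ P := by
      -- If `i < k`, the degree of the monomial exceeds the largest degree in the string.
      by_cases hik : i < k
      · have h0 : linForm d c T ^ u * (c j • gen K d j) ^ v * a = 0 := by
          by_cases hu : s ≤ u
          · rw [← Nat.sub_add_cancel hu, pow_add, mul_right_comm, mul_assoc _ _ a, hprim]
            simp
          · rw [← Nat.sub_add_cancel (show d j ≤ v by omega), pow_add, mul_assoc, mul_assoc _ _ a,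
              smul_gen_pow_mul]
            simp
        rw [h0]
        exact P.zero_mem
      · have hstr := htw.stringSpan_le (i := i - k) hprim (smul_gen_pow_mul (c := c) a) (by omega)
          hdj (by omega)
        obtain ⟨x, hx, hxe⟩ := hstr (monomial_mem_stringSpan _ _ a
          (show u + v = s + d j - 2 - (i - k) by omega))
        have hx' := stringSpan_le_subPart ha _ hx
        rw [Nat.add_sub_cancel' (by omega)] at hx'
        refine ⟨x, hx', ?_⟩
        rw [← hxe, linForm_insert hj, show s + d j - 2 - 2 * (i - k) = m by omega]
    rw [hmono] at hmem
    exact (P.smul_mem_iff (pow_ne_zero _ hc)).1 hmem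
  exact hle hb

end MonomialCI

/-! ### General linear forms, and at most two variables -/

namespace MonomialCI

variable {K : Type*} [Field K] {n : ℕ} {d : Fin n → ℕ}

theorem degreePart_eq_subPart (i : ℕ) : degreePart K d i = subPart K d Finset.univ i := by
  apply le_antisymm
  · rintro _ ⟨f, hf, rfl⟩ e he
    have hlt := lt_of_coeffAt_ne_zero he
    refine ⟨le_topExp_iff.2 fun j => ⟨fun _ => ?_, fun h => absurd (Finset.mem_univ j) h⟩, ?_⟩
    · have := hlt j
      omega
    · rw [Finsupp.degree_eq_weight_one]
      refine hf ?_
      rwa [← coeffAt_mk hlt]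
  · refine subPart_le fun e _ hi => ⟨monomial e 1, ?_, rfl⟩
    exact isHomogeneous_monomial _ hi

theorem mon_zero : mon K d 0 = 1 := rfl

theorem one_mem_subPart (T : Finset (Fin n)) : (1 : MonomialCI K d) ∈ subPart K d T 0 := by
  have h := mon_mem_subPart (K := K) (d := d) (T := T) (e := 0) zero_le
  rwa [mon_zero, map_zero] at h

theorem one_ne_zero' (hd : ∀ i, 1 ≤ d i) : (1 : MonomialCI K d) ≠ 0 := by
  intro h
  have h0 := coeffAt_mon (K := K) (d := d) (e := 0) (e' := 0) hd
  rw [mon_zero, h, map_zero, if_pos rfl] at h0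
  exact zero_ne_one h0

theorem exists_eq_linForm {l : MonomialCI K d} (hl : l ∈ degreePart K d 1) :
    ∃ c, l = linForm d c Finset.univ := by
  have hle : subPart K d Finset.univ 1 ≤ Submodule.span K (Set.range (gen K d)) := by
    refine subPart_le fun e _ he => ?_
    obtain ⟨j, hj⟩ : ∃ j, e j ≠ 0 := by
      by_contra! h
      rw [show e = 0 from Finsupp.ext h, map_zero] at he
      exact zero_ne_one he
    have hdeg : e j + (e.erase j).degree = 1 := by
      rw [← he, ← Finsupp.degree_single j (e j), ← map_add, Finsupp.single_add_erase]
    have h0 : e.erase j = 0 := (Finsupp.degree_eq_zero_iff _).1 (by omega)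
    rw [mon_eq_gen_pow_mul e j, h0, mon_zero, show e j = 1 by omega, pow_one, mul_one]
    exact Submodule.subset_span ⟨j, rfl⟩
  rw [degreePart_eq_subPart] at hl
  obtain ⟨c, hc⟩ := (Submodule.mem_span_range_iff_exists_fun K).1 (hle hl)
  exact ⟨c, hc.symm⟩

/-- The socle degree is only reached by linear forms in which every variable occurs. -/
theorem LefschetzOn.coeff_ne_zero (hd : ∀ i, 2 ≤ d i) {c : Fin n → K}
    (H : LefschetzOn d c Finset.univ) (j : Fin n) : c j ≠ 0 := by
  intro hcj
  have hins : Insert.insert j (Finset.univ.erase j) = (Finset.univ : Finset (Fin n)) :=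
    Finset.insert_erase (Finset.mem_univ j)
  have hl : linForm d c Finset.univ = linForm d c (Finset.univ.erase j) := by
    rw [← hins, linForm_insert (Finset.notMem_erase j _), hcj, zero_smul, add_zero, hins]
  have ht : topDeg d (Finset.univ.erase j) < topDeg d Finset.univ := by
    have h := topDeg_insert (d := d) (Finset.notMem_erase j Finset.univ)
    rw [hins] at h
    have := hd j
    omega
  refine one_ne_zero' (K := K) (d := d) (fun i => by have := hd i; omega)
    (H 0 (by omega) 1 (one_mem_subPart _) ?_)
  rw [hl]
  exact eq_zero_of_mem_subPart (T := Finset.univ.erase j) (by omega)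
    (linForm_pow_mul_mem_subPart (one_mem_subPart _) _)

theorem LefschetzOn.hasStrongLefschetzProperty (hd : ∀ i, 1 ≤ d i) {c : Fin n → K}
    (H : LefschetzOn d c Finset.univ) : HasStrongLefschetzProperty (degreePart K d) := by
  have hl : linForm d c Finset.univ ∈ degreePart K d 1 := by
    have := linForm_pow_mul_mem_subPart (c := c) (one_mem_subPart (K := K) (d := d) Finset.univ) 1
    rwa [pow_one, mul_one, zero_add, ← degreePart_eq_subPart] at this
  refine ⟨_, hl, fun i m _ => ?_⟩
  by_cases h1 : 2 * i + m ≤ topDeg d Finset.univ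
  · left
    rw [← LinearMap.ker_eq_bot, LinearMap.ker_eq_bot']
    rintro ⟨a, ha⟩ h
    have h' : linForm d c Finset.univ ^ m * a = 0 := congrArg Subtype.val h
    refine Subtype.ext (H i (by omega) a (by rwa [← degreePart_eq_subPart]) ?_)
    rw [← Nat.sub_add_cancel (show m ≤ topDeg d Finset.univ - 2 * i by omega), pow_add, mul_assoc,
      h', mul_zero]
  · right
    rintro ⟨b, hb⟩
    rw [degreePart_eq_subPart] at hb
    by_cases h2 : topDeg d Finset.univ < i + m
    · refine ⟨0, Subtype.ext ?_⟩
      rw [map_zero]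
      exact (eq_zero_of_mem_subPart h2 hb).symm
    · set k := topDeg d Finset.univ - (i + m) with hk
      have hsurj := (lefschetzOn_iff_surjective hd).1 H k (i + m - k) (by omega)
      rw [show k + (i + m - k) = i + m by omega] at hsurj
      obtain ⟨a, ha, hab⟩ := hsurj hb
      have ha' := linForm_pow_mul_mem_subPart (c := c) ha (i - k)
      rw [show k + (i - k) = i by omega, ← degreePart_eq_subPart] at ha'
      refine ⟨⟨_, ha'⟩, Subtype.ext ?_⟩
      change linForm d c Finset.univ ^ m * (linForm d c Finset.univ ^ (i - k) * a) = b
      rw [← hab, LinearMap.mulLeft_apply, ← mul_assoc, ← pow_add,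
        show m + (i - k) = i + m - k by omega]

theorem exists_lefschetzOn (hd : ∀ i, 2 ≤ d i)
    (H : HasStrongLefschetzProperty (degreePart K d)) :
    ∃ c : Fin n → K, (∀ i, c i ≠ 0) ∧ LefschetzOn d c Finset.univ := by
  have hd' : ∀ i, 1 ≤ d i := fun i => by have := hd i; omega
  obtain ⟨l, hl, H⟩ := H
  obtain ⟨c, rfl⟩ := exists_eq_linForm hl
  suffices h : LefschetzOn d c Finset.univ from ⟨c, h.coeff_ne_zero hd, h⟩
  intro i hi
  by_cases hm : topDeg d Finset.univ - 2 * i = 0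
  · intro a _ h
    rwa [hm, pow_zero, one_mul] at h
  rcases H i (topDeg d Finset.univ - 2 * i) (by omega) with h | h
  · intro a ha h0
    rw [← degreePart_eq_subPart] at ha
    rw [← LinearMap.ker_eq_bot, LinearMap.ker_eq_bot'] at h
    exact congrArg Subtype.val (h ⟨a, ha⟩ (Subtype.ext h0))
  · refine (linForm_pow_injective_iff_surjective hd' (by omega)).2 fun b hb => ?_
    rw [← degreePart_eq_subPart] at hb
    obtain ⟨a, ha⟩ := h ⟨b, hb⟩
    exact ⟨a, by rw [← degreePart_eq_subPart]; exact a.2, congrArg Subtype.val ha⟩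

theorem hasStrongLefschetzProperty_iff (hd : ∀ i, 2 ≤ d i) :
    HasStrongLefschetzProperty (degreePart K d) ↔
      ∃ c : Fin n → K, (∀ i, c i ≠ 0) ∧ LefschetzOn d c Finset.univ :=
  ⟨exists_lefschetzOn hd, fun ⟨_, _, h⟩ =>
    h.hasStrongLefschetzProperty fun i => by have := hd i; omega⟩

variable {c : Fin n → K}

theorem topDeg_singleton (i : Fin n) : topDeg d {i} = d i - 1 :=
  Finset.sum_singleton _ _

theorem lefschetzOn_singleton (hd : ∀ i, 1 ≤ d i) (hc : ∀ i, c i ≠ 0) (i : Fin n) :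
    LefschetzOn d c {i} := by
  rw [← insert_empty_eq i]
  refine lefschetzOn_empty.insert hd (Finset.notMem_empty i) (hc i) fun k hk _ => ?_
  rw [show topDeg d (∅ : Finset (Fin n)) = 0 from Finset.sum_empty, Nat.zero_sub, zero_add]
  exact twoVarLefschetz_one_left K _

/-- The algebra `K[x] / (x ^ d)` has no primitive elements of positive degree. -/
theorem eq_zero_of_primitive_singleton (hd : ∀ i, 1 ≤ d i) (hc : ∀ i, c i ≠ 0) {i : Fin n}
    {k : ℕ} (hk0 : 1 ≤ k) (hk : 2 * k ≤ topDeg d {i}) {a : MonomialCI K d}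
    (ha : a ∈ subPart K d {i} k) (h : linForm d c {i} ^ (topDeg d {i} - 2 * k + 1) * a = 0) :
    a = 0 := by
  have hlin : linForm d c {i} = c i • gen K d i := Finset.sum_singleton _ _
  have hle : subPart K d {i} k ≤
      (subPart K d {i} (k - 1)).map (LinearMap.mulLeft K (linForm d c {i})) := by
    rw [← insert_empty_eq i]
    refine subPart_insert_le (Finset.notMem_empty i) fun v w hvw b hb => ?_
    rw [insert_empty_eq]
    rcases Nat.eq_zero_or_pos w with rfl | hw
    · refine ⟨(c i)⁻¹ • (gen K d i ^ (k - 1) * b), Submodule.smul_mem _ _ ?_, ?_⟩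
      · have := gen_pow_mul_mem_subPart (Finset.mem_singleton_self i) (k - 1)
          (subPart_mono (Finset.empty_subset {i}) _ hb)
        rwa [zero_add] at this
      · rw [LinearMap.mulLeft_apply, hlin, smul_mul_smul_comm, mul_inv_cancel₀ (hc i), one_smul,
          ← mul_assoc, ← pow_succ', show k - 1 + 1 = v by omega]
    · rw [eq_zero_of_mem_subPart (T := ∅) (by simpa [topDeg] using hw) hb, mul_zero]
      exact Submodule.zero_mem _
  obtain ⟨b, hb, rfl⟩ := hle ha
  rw [LinearMap.mulLeft_apply] at h ⊢
  rw [← mul_assoc, ← pow_succ, show topDeg d {i} - 2 * k + 1 + 1 = topDeg d {i} - 2 * (k - 1)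
    by omega] at h
  rw [lefschetzOn_singleton hd hc i (k - 1) (by omega) b hb h, mul_zero]

theorem lefschetzOn_pair_iff (hd : ∀ i, 1 ≤ d i) (hc : ∀ i, c i ≠ 0) {i j : Fin n} (hij : i ≠ j) :
    LefschetzOn d c {j, i} ↔ TwoVarLefschetz K (d i) (d j) := by
  have hj : j ∉ ({i} : Finset (Fin n)) := by simpa using hij.symm
  have hdi := hd i
  have ht : topDeg d {i} - 2 * 0 + 1 = d i := by rw [topDeg_singleton]; omega
  constructor
  · intro H
    have := H.twoVarLefschetz hd hj (hc j) (i := 0) (by omega) (one_mem_subPart _)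
      (one_ne_zero' hd) (eq_zero_of_mem_subPart (T := {i}) (by omega)
        (linForm_pow_mul_mem_subPart (one_mem_subPart _) _))
    rwa [ht] at this
  · intro H
    refine (lefschetzOn_singleton hd hc i).insert hd hj (hc j) ?_
    rintro k hk ⟨a, ha, ha0, hprim⟩
    rcases Nat.eq_zero_or_pos k with rfl | hk0
    · rwa [ht]
    · exact absurd (eq_zero_of_primitive_singleton hd hc hk0 hk ha hprim) ha0

/-- In two variables the Hilbert function increases strictly up to the smaller exponent, so that
there are primitive elements in all these degrees. -/
theorem exists_primitive_pair (hd : ∀ i, 1 ≤ d i) {i j : Fin n} (hij : i ≠ j) {k : ℕ}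
    (hki : k < d i) (hkj : k < d j) :
    ∃ a ∈ subPart K d {j, i} k, a ≠ 0 ∧
      linForm d c {j, i} ^ (topDeg d {j, i} - 2 * k + 1) * a = 0 := by
  have ht : topDeg d {j, i} = d j - 1 + (d i - 1) := Finset.sum_pair hij.symm
  set T : Finset (Fin n) := {j, i} with hT
  have hiT : i ∈ T := by simp [hT]
  have hjT : j ∈ T := by simp [hT]
  rcases Nat.eq_zero_or_pos k with rfl | hk
  · exact ⟨1, one_mem_subPart _, one_ne_zero' hd, eq_zero_of_mem_subPart (T := T) (by omega)
      (linForm_pow_mul_mem_subPart (one_mem_subPart _) _)⟩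
  have := finiteDimensional_subPart (K := K) hd T k
  have := finiteDimensional_subPart (K := K) hd T (k + (topDeg d T - 2 * k + 1))
  let f : subPart K d T k →ₗ[K] subPart K d T (k + (topDeg d T - 2 * k + 1)) :=
    (LinearMap.mulLeft K (linForm d c T ^ (topDeg d T - 2 * k + 1))).restrict
      fun b hb => linForm_pow_mul_mem_subPart hb _
  have hker : LinearMap.ker f ≠ ⊥ := by
    refine LinearMap.ker_ne_bot_of_finrank_lt ?_
    rw [← finrank_subPart_symm hd (i := k - 1) (by omega), finrank_subPart hd, finrank_subPart hd]
    have hinj : Function.Injective fun e : Fin n →₀ ℕ => e + Finsupp.single i 1 :=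
      add_left_injective _
    rw [← Finset.card_image_of_injective _ hinj]
    refine Finset.card_lt_card ((Finset.ssubset_iff_of_subset ?_).2
      ⟨Finsupp.single j k, ?_, ?_⟩)
    · intro e' he'
      obtain ⟨e, he, rfl⟩ := Finset.mem_image.1 he'
      rw [mem_expFinset, le_topExp_iff] at he ⊢
      refine ⟨fun l => ?_, by rw [map_add, he.2, Finsupp.degree_single]; omega⟩
      have hle := Finsupp.le_degree i e
      rcases eq_or_ne l i with rfl | hl
      · simp only [Finsupp.add_apply, Finsupp.single_eq_same]
        exact ⟨fun _ => by omega, fun h => absurd hiT h⟩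
      · simpa [Finsupp.single_eq_of_ne hl] using he.1 l
    · rw [mem_expFinset, le_topExp_iff]
      refine ⟨fun l => ?_, Finsupp.degree_single _ _⟩
      rcases eq_or_ne l j with rfl | hl
      · simp only [Finsupp.single_eq_same]
        exact ⟨fun _ => by omega, fun h => absurd hjT h⟩
      · simp [Finsupp.single_eq_of_ne hl]
    · intro h
      obtain ⟨e, _, he⟩ := Finset.mem_image.1 h
      have := DFunLike.congr_fun he i
      simp [Finsupp.single_eq_of_ne hij] at this
  obtain ⟨a, ha, ha0⟩ := (Submodule.ne_bot_iff _).1 hker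
  exact ⟨a, a.2, fun h => ha0 (Subtype.ext h), congrArg Subtype.val (LinearMap.mem_ker.1 ha)⟩

end MonomialCI

/-! ### Base `p` digits -/

theorem baseDigit_eq {p : ℕ} (hp : 2 ≤ p) (m j : ℕ) : baseDigit p m j = m / p ^ j % p :=
  Nat.getD_digits m j hp

theorem baseDigit_zero {p : ℕ} (hp : 2 ≤ p) (m : ℕ) : baseDigit p m 0 = m % p := by
  rw [baseDigit_eq hp, pow_zero, Nat.div_one]

theorem topIndex_eq {p m : ℕ} (hp : 2 ≤ p) (hm : m ≠ 0) : topIndex p m = Nat.log p m := by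
  rw [topIndex, Nat.length_digits p m (by omega) hm, Nat.add_sub_cancel]

theorem baseDigit_topIndex_eq {p a : ℕ} (hp2 : 2 ≤ p) (ha : a ≠ 0) :
    baseDigit p a (topIndex p a) = a / p ^ topIndex p a := by
  have hlt : a < p ^ (topIndex p a + 1) := by
    rw [topIndex_eq hp2 ha]
    exact Nat.lt_pow_succ_log_self (by omega) a
  rw [baseDigit_eq hp2, Nat.mod_eq_of_lt]
  rwa [Nat.div_lt_iff_lt_mul (by positivity), mul_comm, ← pow_succ]

theorem mod_pow_succ_eq {p : ℕ} (hp : 2 ≤ p) (m e : ℕ) :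
    m % p ^ (e + 1) = m % p ^ e + p ^ e * baseDigit p m e := by
  rw [baseDigit_eq hp, Nat.mod_pow_succ]

/-- The residues of `b` modulo `Q` and modulo a multiple `q` of `Q`: neither the distance from `0`
nor that from the modulus decreases. -/
theorem mod_le_mod_of_dvd {Q q : ℕ} (b : ℕ) (hq : 0 < q) (h : Q ∣ q) :
    b % Q ≤ b % q ∧ b % q + Q ≤ q + b % Q := by
  obtain ⟨k, rfl⟩ := h
  have hQ : 0 < Q := Nat.pos_of_mul_pos_right hq
  have hlt := Nat.mod_lt b hq
  have h1 : b % (Q * k) % Q = b % Q := Nat.mod_mul_right_mod b Q k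
  have h2 := Nat.mod_add_div (b % (Q * k)) Q
  rw [h1] at h2
  refine ⟨by omega, ?_⟩
  have h3 : b % (Q * k) / Q + 1 ≤ k := (Nat.div_lt_iff_lt_mul hQ).2 (by rwa [mul_comm k Q])
  have h4 := Nat.mul_le_mul_left Q h3
  rw [mul_add, mul_one] at h4
  omega

/-- `x` is one of the two integers nearest to `q / 2`, for odd `q`. -/
def IsNearHalf (q x : ℕ) : Prop := 2 * x + 1 = q ∨ 2 * x = q + 1

theorem isNearHalf_iff {p x : ℕ} (hp : Odd p) :
    IsNearHalf p x ↔ x = (p - 1) / 2 ∨ x = (p + 1) / 2 := by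
  obtain ⟨h, rfl⟩ := hp
  rw [IsNearHalf]
  omega

/-- The number formed by the lowest `e + 1` digits is near `p ^ (e + 1) / 2` exactly when the
digit with index `e` is the middle digit `(p - 1) / 2`. -/
theorem isNearHalf_mod_pow_succ {p m e : ℕ} (hp : Odd p) (hp2 : 2 < p) (he : 1 ≤ e)
    (h : IsNearHalf (p ^ e) (m % p ^ e)) :
    IsNearHalf (p ^ (e + 1)) (m % p ^ (e + 1)) ↔ baseDigit p m e = (p - 1) / 2 := by
  have hQ : 3 ≤ p ^ e := le_trans hp2 (Nat.le_self_pow (by omega) p)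
  rw [mod_pow_succ_eq (by omega), pow_succ]
  obtain ⟨k, hk⟩ := hp
  generalize baseDigit p m e = D at *
  rw [IsNearHalf] at h ⊢
  have hpQ : p ^ e * p = 2 * (p ^ e * k) + p ^ e := by
    have h1 : p ^ e * p = p ^ e * (2 * k + 1) := congrArg _ hk
    rw [h1]
    ring
  rw [hpQ, show (p - 1) / 2 = k by omega]
  generalize p ^ e = Q at *
  constructor
  · intro h'
    rcases lt_trichotomy D k with hlt | heq | hgt
    · have := Nat.mul_le_mul_left Q (show D + 1 ≤ k from hlt)
      rw [mul_add, mul_one] at this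
      omega
    · exact heq
    · have := Nat.mul_le_mul_left Q (show k + 1 ≤ D from hgt)
      rw [mul_add, mul_one] at this
      omega
  · rintro rfl
    omega

section TwoVariables

variable {K : Type*} [Field K] {p : ℕ} [Fact p.Prime] [CharP K p]

/-- For a small exponent `a`, only one power of `p` matters. -/
theorem PrimePowerCondition.of_dvd {Q q a b : ℕ} (hq : 0 < q) (hQ : Q ∣ q) (haQ : a < Q)
    (h : PrimePowerCondition Q a b) : PrimePowerCondition q a b := by
  have h1 := mod_le_mod_of_dvd b hq hQ
  have h2 := h.2 haQ
  have h3 := Nat.le_of_dvd hq hQ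
  exact ⟨fun h' => by omega, fun _ => by omega⟩

variable (p) in
theorem twoVarLefschetz_iff_of_lt {a b : ℕ} (ha : 2 ≤ a) (hab : a ≤ b) (hap : a < p) :
    TwoVarLefschetz K a b ↔ a ≤ b % p + 1 ∧ a + b % p ≤ p + 1 := by
  have hp : p.Prime := Fact.out
  rw [twoVarLefschetz_iff (p := p) ha hab]
  constructor
  · intro h
    have := (h 1 le_rfl).2
    rw [pow_one] at this
    exact this hap
  · intro h e he
    exact PrimePowerCondition.of_dvd (pow_pos hp.pos e) (dvd_pow_self p (by omega)) hap
      ⟨fun h' => by omega, fun _ => h⟩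

variable (p) in
theorem twoVarLefschetz_of_add_le {a b : ℕ} (ha : 1 ≤ a) (hb : 2 ≤ b) (h : a + b ≤ p + 1) :
    TwoVarLefschetz K a b := by
  rcases Nat.lt_or_ge 1 a with ha' | ha'
  · have key : ∀ a b : ℕ, 2 ≤ a → a ≤ b → a + b ≤ p + 1 → TwoVarLefschetz K a b := by
      intro a b ha hab h
      rcases lt_or_ge b p with hbp | hbp
      · rw [twoVarLefschetz_iff_of_lt p ha hab (by omega), Nat.mod_eq_of_lt hbp]
        omega
      · omega
    rcases le_total a b with hab | hab
    · exact key a b ha' hab h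
    · rw [twoVarLefschetz_comm p]
      exact key b a hb hab (by omega)
  · rw [show a = 1 by omega]
    exact twoVarLefschetz_one_left K b

variable (p) in
/-- A string whose length is divisible by `p` does not admit a second variable. -/
theorem not_twoVarLefschetz_of_dvd {a b : ℕ} (hp2 : 2 < p) (ha : p ≤ a) (hpa : p ∣ a)
    (hb : 2 ≤ b) : ¬ TwoVarLefschetz K a b := by
  intro h
  have ha0 := Nat.mod_eq_zero_of_dvd hpa
  rcases le_total a b with hab | hab
  · have := (twoVarLefschetz_iff (p := p) (by omega) hab).1 h 1 le_rfl
    rw [pow_one, PrimePowerCondition] at this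
    omega
  · rw [twoVarLefschetz_comm p] at h
    have := (twoVarLefschetz_iff (p := p) hb hab).1 h 1 le_rfl
    rw [pow_one, PrimePowerCondition] at this
    omega

theorem twoVarLefschetz_two_iff [CharP K 2] {a b : ℕ} (ha : 2 ≤ a) (hab : a ≤ b) :
    TwoVarLefschetz K a b ↔ (a = 2 ∧ b % 2 = 1) ∨ (a = 3 ∧ b % 4 = 2) := by
  have : Fact (Nat.Prime 2) := ⟨Nat.prime_two⟩
  rw [twoVarLefschetz_iff (p := 2) ha hab]
  constructor
  · intro h
    have h1 := h 1 (by omega)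
    have h2 := h 2 (by omega)
    have h3 := h 3 (by omega)
    norm_num [PrimePowerCondition] at h1 h2 h3
    omega
  · intro h e he
    have h1 : PrimePowerCondition 2 a b := by
      rw [PrimePowerCondition]
      omega
    have h2 : PrimePowerCondition 4 a b := by
      rw [PrimePowerCondition]
      omega
    rcases Nat.lt_or_ge 1 e with he' | he'
    · exact PrimePowerCondition.of_dvd (by positivity) (pow_dvd_pow 2 he') (by omega) h2
    · rwa [show e = 1 by omega, pow_one]

/-- The digit condition for two variables in odd characteristic. -/
theorem twoVarLefschetz_iff_digits (hp : Odd p) (hp2 : 2 < p) {a b : ℕ} (hpa : p ≤ a)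
    (hab : a ≤ b) :
    TwoVarLefschetz K a b ↔ (IsNearHalf p (baseDigit p a 0) ∧ IsNearHalf p (baseDigit p b 0)) ∧
      (∀ r : ℕ, 1 ≤ r → r < topIndex p a →
        baseDigit p a r = (p - 1) / 2 ∧ baseDigit p b r = (p - 1) / 2) ∧
      baseDigit p a (topIndex p a) + baseDigit p b (topIndex p a) < p ∧
      baseDigit p a (topIndex p a) ≤ baseDigit p b (topIndex p a) := by
  have hpp : p.Prime := Fact.out
  rw [twoVarLefschetz_iff (p := p) (by omega) hab, topIndex_eq (by omega) (by omega)]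
  set k := Nat.log p a with hk
  have hk1 : 1 ≤ k := Nat.le_log_of_pow_le hpp.one_lt (by rwa [pow_one])
  have hle : ∀ e, e ≤ k → p ^ e ≤ a := fun e he => Nat.pow_le_of_le_log (by omega) he
  have hlt : ∀ e, k < e → a < p ^ e := fun e he => Nat.lt_pow_of_log_lt hpp.one_lt he
  have hpow : ∀ e, 1 ≤ e → 3 ≤ p ^ e := fun e he =>
    le_trans hp2 (Nat.le_self_pow (by omega) p)
  have hdig : (IsNearHalf p (baseDigit p a 0) ∧ IsNearHalf p (baseDigit p b 0)) ↔
      IsNearHalf (p ^ 1) (a % p ^ 1) ∧ IsNearHalf (p ^ 1) (b % p ^ 1) := by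
    rw [pow_one, baseDigit_zero (by omega), baseDigit_zero (by omega)]
  have hQ := hpow k hk1
  have ha := mod_pow_succ_eq (p := p) (by omega) a k
  have hb := mod_pow_succ_eq (p := p) (by omega) b k
  rw [Nat.mod_eq_of_lt (hlt (k + 1) (by omega))] at ha
  have hcond : ∀ q, q ≤ a → Odd q → (PrimePowerCondition q a b ↔
      IsNearHalf q (a % q) ∧ IsNearHalf q (b % q)) := by
    rintro q hqa ⟨m, hm⟩
    rw [PrimePowerCondition, IsNearHalf, IsNearHalf]
    generalize a % q = x
    generalize b % q = y
    omega
  constructor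
  · intro h
    have hhalf : ∀ e, 1 ≤ e → e ≤ k →
        IsNearHalf (p ^ e) (a % p ^ e) ∧ IsNearHalf (p ^ e) (b % p ^ e) :=
      fun e he1 he2 => (hcond _ (hle e he2) hp.pow).1 (h e he1)
    have htop := (h (k + 1) (by omega)).2 (hlt (k + 1) (by omega))
    obtain ⟨hka, hkb⟩ := hhalf k hk1 le_rfl
    rw [IsNearHalf] at hka hkb
    rw [hb, pow_succ] at htop
    refine ⟨hdig.2 (hhalf 1 le_rfl hk1), fun r hr1 hr2 => ?_, ?_, ?_⟩
    · exact ⟨(isNearHalf_mod_pow_succ hp hp2 hr1 (hhalf r hr1 hr2.le).1).1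
          (hhalf (r + 1) (by omega) hr2).1,
        (isNearHalf_mod_pow_succ hp hp2 hr1 (hhalf r hr1 hr2.le).2).1
          (hhalf (r + 1) (by omega) hr2).2⟩
    · by_contra! hc
      have := Nat.mul_le_mul_left (p ^ k) hc
      rw [mul_add] at this
      omega
    · by_contra! hc
      have := Nat.mul_le_mul_left (p ^ k) (Nat.succ_le_of_lt hc)
      rw [Nat.succ_eq_add_one, mul_add, mul_one] at this
      omega
  · rintro ⟨h0, hmid, hsum, htop⟩
    have hhalf : ∀ e, 1 ≤ e → e ≤ k →
        IsNearHalf (p ^ e) (a % p ^ e) ∧ IsNearHalf (p ^ e) (b % p ^ e) := by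
      intro e he1
      induction e, he1 using Nat.le_induction with
      | base => exact fun _ => hdig.1 h0
      | succ e he1 ih =>
        intro hek
        obtain ⟨h1, h2⟩ := ih (by omega)
        obtain ⟨h3, h4⟩ := hmid e he1 (by omega)
        exact ⟨(isNearHalf_mod_pow_succ hp hp2 he1 h1).2 h3,
          (isNearHalf_mod_pow_succ hp hp2 he1 h2).2 h4⟩
    intro e he
    rcases Nat.lt_or_ge k e with hke | hke
    · refine PrimePowerCondition.of_dvd (pow_pos hpp.pos e) (pow_dvd_pow p hke)
        (hlt (k + 1) (by omega)) ⟨fun h' => absurd (hlt (k + 1) (by omega)) (not_lt.2 h'),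
          fun _ => ?_⟩
      obtain ⟨hka, hkb⟩ := hhalf k hk1 le_rfl
      rw [IsNearHalf] at hka hkb
      have h1 := Nat.mul_le_mul_left (p ^ k) htop
      have h2 := Nat.mul_le_mul_left (p ^ k) (Nat.succ_le_of_lt hsum)
      rw [Nat.succ_eq_add_one, mul_add, mul_add, mul_one] at h2
      rw [hb, pow_succ]
      omega
    · exact (hcond _ (hle e hke) hp.pow).2 (hhalf e he hke)

/-- The digit condition implies the Lefschetz property also when `a` has a single digit, and when
`a` and `b` have equally many digits and are not ordered by size. -/
theorem twoVarLefschetz_of_digits (hp : Odd p) (hp2 : 2 < p) {a b : ℕ} (ha : 2 ≤ a) (hb : 2 ≤ b)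
    (htop : topIndex p a ≤ topIndex p b)
    (h : ((baseDigit p a 0 = (p - 1) / 2 ∨ baseDigit p a 0 = (p + 1) / 2) ∧
          (baseDigit p b 0 = (p - 1) / 2 ∨ baseDigit p b 0 = (p + 1) / 2)) ∧
        (∀ r : ℕ, 1 ≤ r → r < topIndex p a →
          baseDigit p a r = (p - 1) / 2 ∧ baseDigit p b r = (p - 1) / 2) ∧
        baseDigit p a (topIndex p a) + baseDigit p b (topIndex p a) < p ∧
        (topIndex p a < topIndex p b →
          baseDigit p a (topIndex p a) ≤ baseDigit p b (topIndex p a))) :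
    TwoVarLefschetz K a b := by
  obtain ⟨h0, hmid, hsum, hlast⟩ := h
  rcases lt_or_ge a p with hap | hap
  · -- Both residues modulo `p` are `(p - 1) / 2`.
    have htop0 : topIndex p a = 0 := by
      rw [topIndex_eq hp2.le (by omega)]
      exact Nat.log_of_lt hap
    rw [htop0] at hsum
    rw [baseDigit_zero hp2.le, baseDigit_zero hp2.le] at h0 hsum
    rw [Nat.mod_eq_of_lt hap] at h0 hsum
    obtain ⟨k, hk⟩ := hp
    have hab : a ≤ b := by
      have := Nat.mod_le b p
      omega
    rw [twoVarLefschetz_iff_of_lt p ha hab hap]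
    omega
  · have hpb : p ≤ b := by
      by_contra! hbp
      rw [topIndex_eq hp2.le (by omega), topIndex_eq hp2.le (by omega), Nat.log_of_lt hbp] at htop
      have : 1 ≤ Nat.log p a := Nat.le_log_of_pow_le (by omega) (by rwa [pow_one])
      omega
    rw [← isNearHalf_iff hp, ← isNearHalf_iff hp] at h0
    rcases eq_or_lt_of_le htop with heq | hlt
    · -- The condition is symmetric when both numbers have the same number of digits.
      have hcmp : ∀ {x y : ℕ}, 2 ≤ x → 2 ≤ y → x ≤ y → topIndex p x = topIndex p y →
          baseDigit p x (topIndex p x) ≤ baseDigit p y (topIndex p x) := by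
        intro x y hx hy hxy ht
        rw [baseDigit_topIndex_eq hp2.le (by omega), ht, baseDigit_topIndex_eq hp2.le (by omega)]
        exact Nat.div_le_div_right hxy
      rcases le_total a b with hab | hab
      · exact (twoVarLefschetz_iff_digits hp hp2 hap hab).2
          ⟨h0, hmid, hsum, hcmp ha hb hab heq⟩
      · rw [twoVarLefschetz_comm p]
        rw [heq] at hmid hsum
        exact (twoVarLefschetz_iff_digits hp hp2 hpb hab).2
          ⟨h0.symm, fun r h1 h2 => (hmid r h1 h2).symm, by omega, hcmp hb ha hab heq.symm⟩
    · have hab : a ≤ b := by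
        by_contra! hba
        rw [topIndex_eq hp2.le (by omega), topIndex_eq hp2.le (by omega)] at hlt
        exact absurd (Nat.log_mono_right (b := p) hba.le) (not_le.2 hlt)
      exact (twoVarLefschetz_iff_digits hp hp2 hap hab).2 ⟨h0, hmid, hsum, hlast hlt⟩

end TwoVariables

/-! ### Several variables -/

namespace MonomialCI

variable {K : Type*} [Field K] {p : ℕ} [Fact p.Prime] [CharP K p] {n : ℕ} {d : Fin n → ℕ}
  {c : Fin n → K}

theorem LefschetzOn.twoVarLefschetz_pair (hd : ∀ i, 1 ≤ d i) (hc : ∀ i, c i ≠ 0)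
    (H : LefschetzOn d c Finset.univ) {i j : Fin n} (hij : i ≠ j) :
    TwoVarLefschetz K (d i) (d j) :=
  (lefschetzOn_pair_iff hd hc hij).1 (H.mono hd (Finset.subset_univ _))

/-- The case of the primitive element `1`, which has degree zero. -/
theorem LefschetzOn.twoVarLefschetz_topDeg (hd : ∀ i, 1 ≤ d i) {T : Finset (Fin n)} {j : Fin n}
    (hj : j ∉ T) (hc : ∀ i, c i ≠ 0) (H : LefschetzOn d c (Insert.insert j T)) :
    TwoVarLefschetz K (topDeg d T + 1) (d j) := by
  refine H.twoVarLefschetz hd hj (hc j) (i := 0) (by omega) (one_mem_subPart _)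
    (one_ne_zero' hd) (eq_zero_of_mem_subPart (T := T) (by omega)
      (linForm_pow_mul_mem_subPart (one_mem_subPart _) _))

/-- Two exponents that are at least `p` do not leave room for a third variable: the algebra in the
first two variables has a primitive element that spans a string whose length is divisible
by `p`. -/
theorem not_lefschetzOn_triple (hp2 : 2 < p) (hd : ∀ i, 2 ≤ d i) (hc : ∀ i, c i ≠ 0)
    {i j k : Fin n} (hij : i ≠ j) (hki : k ≠ i) (hkj : k ≠ j) (hi : p ≤ d i) (hj : p ≤ d j) :
    ¬ LefschetzOn d c Finset.univ := by
  intro H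
  have hd' : ∀ i, 1 ≤ d i := fun i => by have := hd i; omega
  have hpp : p.Prime := Fact.out
  obtain ⟨h, hh⟩ := hpp.odd_of_ne_two (by omega)
  have hk : k ∉ ({j, i} : Finset (Fin n)) := by simp [hki, hkj]
  have ht : topDeg d {j, i} = d j - 1 + (d i - 1) := Finset.sum_pair hij.symm
  -- `m` solves `2 * m ≡ d i + d j - 1` modulo `p`.
  obtain ⟨m, hm, hdvd⟩ : ∃ m < p, p ∣ topDeg d {j, i} - 2 * m + 1 := by
    have h1 := Nat.mod_add_div (topDeg d {j, i} + 1) p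
    have h2 := Nat.mod_lt (topDeg d {j, i} + 1) hpp.pos
    rcases Nat.even_or_odd' ((topDeg d {j, i} + 1) % p) with ⟨r, hr | hr⟩
    · refine ⟨r, by omega, ?_⟩
      rw [show topDeg d {j, i} - 2 * r + 1 = p * ((topDeg d {j, i} + 1) / p) by omega]
      exact dvd_mul_right _ _
    · refine ⟨r + h + 1, by omega, ?_⟩
      rw [← Nat.dvd_add_self_right, show topDeg d {j, i} - 2 * (r + h + 1) + 1 + p =
        p * ((topDeg d {j, i} + 1) / p) by omega]
      exact dvd_mul_right _ _
  obtain ⟨a, ha, ha0, hprim⟩ := exists_primitive_pair (c := c) hd' hij (k := m) (by omega)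
    (by omega)
  exact not_twoVarLefschetz_of_dvd p hp2 (Nat.le_of_dvd (by omega) hdvd) hdvd (hd k)
    ((H.mono hd' (Finset.subset_univ _)).twoVarLefschetz hd' hk (hc k) (by omega) ha ha0 hprim)

variable (p) in
/-- The variables of `T` are added one at a time; in each step, the primitive element `1` spans a
string whose length is limited by the condition in two variables. -/
theorem LefschetzOn.topDeg_lt (hd : ∀ i, 2 ≤ d i) (hc : ∀ i, c i ≠ 0) {T : Finset (Fin n)}
    (hT : ∀ i ∈ T, d i < p) (H : LefschetzOn d c T) : topDeg d T < p := by
  have hd' : ∀ i, 1 ≤ d i := fun i => by have := hd i; omega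
  have hpp : p.Prime := Fact.out
  induction T using Finset.induction_on with
  | empty => exact hpp.pos
  | insert j T hj ih =>
    have hlt := ih (fun i hi => hT i (Finset.mem_insert_of_mem hi)) (H.of_insert hd' hj)
    have htwo := H.twoVarLefschetz_topDeg hd' hj hc
    have hdj := hd j
    have hjp := hT j (Finset.mem_insert_self j T)
    rw [topDeg_insert hj]
    rcases Nat.eq_zero_or_pos (topDeg d T) with h0 | h0
    · omega
    rcases le_total (topDeg d T + 1) (d j) with hle | hle
    · rw [twoVarLefschetz_iff_of_lt p (by omega) hle (by omega), Nat.mod_eq_of_lt hjp] at htwo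
      omega
    · rw [twoVarLefschetz_comm p, twoVarLefschetz_iff_of_lt p hdj hle hjp] at htwo
      rcases eq_or_lt_of_le (show topDeg d T + 1 ≤ p from hlt) with heq | hlt'
      · rw [heq, Nat.mod_self] at htwo
        omega
      · rw [Nat.mod_eq_of_lt hlt'] at htwo
        omega

variable (p) in
theorem lefschetzOn_of_topDeg_lt (hd : ∀ i, 2 ≤ d i) (hc : ∀ i, c i ≠ 0) {T : Finset (Fin n)}
    (hT : topDeg d T < p) : LefschetzOn d c T := by
  have hd' : ∀ i, 1 ≤ d i := fun i => by have := hd i; omega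
  induction T using Finset.induction_on with
  | empty => exact lefschetzOn_empty
  | insert j T hj ih =>
    rw [topDeg_insert hj] at hT
    have hdj := hd j
    exact (ih (by omega)).insert hd' hj (hc j) fun i _ _ =>
      twoVarLefschetz_of_add_le p (by omega) hdj (by omega)

variable (p) in
/-- The case of exactly one exponent that is at least `p`. -/
theorem lefschetzOn_insert_iff (hd : ∀ i, 2 ≤ d i) (hc : ∀ i, c i ≠ 0) {T : Finset (Fin n)}
    {j k : Fin n} (hj : j ∉ T) (hk : k ∈ T) (hjp : p ≤ d j) (hT : ∀ i ∈ T, d i < p) :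
    LefschetzOn d c (Insert.insert j T) ↔ topDeg d T ≤ min (d j % p) (p - d j % p) := by
  have hd' : ∀ i, 1 ≤ d i := fun i => by have := hd i; omega
  have hpp : p.Prime := Fact.out
  have hp2 : 2 < p := (hd k).trans_lt (hT k hk)
  have h1 : 1 ≤ topDeg d T := by
    have := Finset.single_le_sum (f := fun i => d i - 1) (fun _ _ => Nat.zero_le _) hk
    have := hd k
    rw [topDeg]
    omega
  have hmod := Nat.mod_lt (d j) hpp.pos
  rw [le_min_iff]
  constructor
  · intro H
    have hlt := (H.of_insert hd' hj).topDeg_lt p hd hc hT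
    have htwo := H.twoVarLefschetz_topDeg hd' hj hc
    rcases eq_or_lt_of_le (show topDeg d T + 1 ≤ p from hlt) with heq | hlt'
    · rw [heq] at htwo
      exact absurd htwo (not_twoVarLefschetz_of_dvd p hp2 le_rfl dvd_rfl (hd j))
    · rw [twoVarLefschetz_iff_of_lt p (by omega) (by omega) hlt'] at htwo
      omega
  · intro h
    refine (lefschetzOn_of_topDeg_lt p hd hc (by omega)).insert hd' hj (hc j) fun i _ _ => ?_
    rcases Nat.eq_zero_or_pos (topDeg d T - 2 * i) with h0 | h0
    · rw [h0]
      exact twoVarLefschetz_one_left K _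
    · rw [twoVarLefschetz_iff_of_lt p (by omega) (by omega) (by omega)]
      omega

end MonomialCI

theorem mainTheorem2 {K : Type*} [Field K] (p : ℕ) [CharP K p] (hp : 0 < p)
    (n : ℕ) (hn : 1 ≤ n) (d : Fin n → ℕ) (hd : ∀ i, 2 ≤ d i) :
    HasStrongLefschetzProperty (MonomialCI.degreePart K d) ↔
      n = 1 ∨
      (n = 2 ∧ p = 2 ∧ ∃ i j : Fin n, i ≠ j ∧ d i ≤ d j ∧
        ((d i = 2 ∧ baseDigit p (d j) 0 = 1) ∨
          (d i = 3 ∧ baseDigit p (d j) 1 = 1 ∧ baseDigit p (d j) 0 = 0))) ∨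
      (n = 2 ∧ 2 < p ∧ ∃ i j : Fin n, i ≠ j ∧ topIndex p (d i) ≤ topIndex p (d j) ∧
        ((baseDigit p (d i) 0 = (p - 1) / 2 ∨ baseDigit p (d i) 0 = (p + 1) / 2) ∧
          (baseDigit p (d j) 0 = (p - 1) / 2 ∨ baseDigit p (d j) 0 = (p + 1) / 2)) ∧
        (∀ r : ℕ, 1 ≤ r → r < topIndex p (d i) →
          baseDigit p (d i) r = (p - 1) / 2 ∧ baseDigit p (d j) r = (p - 1) / 2) ∧
        baseDigit p (d i) (topIndex p (d i)) + baseDigit p (d j) (topIndex p (d i)) < p ∧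
        (topIndex p (d i) < topIndex p (d j) →
          baseDigit p (d i) (topIndex p (d i)) ≤ baseDigit p (d j) (topIndex p (d i)))) ∨
      (2 ≤ n ∧ ∑ i, (d i - 1) < p) ∨
      (2 ≤ n ∧ ∃ j : Fin n, p ≤ d j ∧ (∀ i, i ≠ j → d i < p) ∧
        ∑ i ∈ Finset.univ.erase j, (d i - 1) ≤
          min (baseDigit p (d j) 0) (p - baseDigit p (d j) 0)) := by
  have hpp : p.Prime := (CharP.char_is_prime_or_zero K p).resolve_right (by omega)
  have : Fact p.Prime := ⟨hpp⟩
  have hd' : ∀ i, 1 ≤ d i := fun i => by have := hd i; omega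
  have hp2 := hpp.two_le
  rw [MonomialCI.hasStrongLefschetzProperty_iff hd]
  have hsorted : ∀ {i j : Fin n}, i ≠ j → ∃ i' j' : Fin n, i' ≠ j' ∧ d i' ≤ d j' ∧
      (d i' = d i ∨ d i' = d j) := by
    intro i j hij
    rcases le_total (d i) (d j) with h | h
    · exact ⟨i, j, hij, h, Or.inl rfl⟩
    · exact ⟨j, i, hij.symm, h, Or.inr rfl⟩
  constructor
  · rintro ⟨c, hc, H⟩
    rcases eq_or_lt_of_le hn with h1 | hn2
    · exact Or.inl h1.symm
    right
    have hpair := fun {i j : Fin n} (hij : i ≠ j) => H.twoVarLefschetz_pair hd' hc hij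
    let i₀ : Fin n := ⟨0, by omega⟩
    let i₁ : Fin n := ⟨1, by omega⟩
    have h01 : i₀ ≠ i₁ := by simp [i₀, i₁, Fin.ext_iff]
    rcases eq_or_lt_of_le hp2 with rfl | hp2
    · left
      rcases eq_or_lt_of_le (show 2 ≤ n from hn2) with h2 | hn3
      · refine ⟨h2.symm, rfl, ?_⟩
        obtain ⟨i, j, hij, hle, -⟩ := hsorted h01
        refine ⟨i, j, hij, hle, ?_⟩
        have := (twoVarLefschetz_two_iff (hd i) hle).1 (hpair hij)
        rw [baseDigit_zero le_rfl, baseDigit_eq le_rfl, pow_one]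
        omega
      · exfalso
        -- Any two of the exponents have different parities.
        have hodd : ∀ {i j : Fin n}, i ≠ j → d i % 2 ≠ d j % 2 := by
          intro i j hij
          rcases le_total (d i) (d j) with h | h
          · have := (twoVarLefschetz_two_iff (hd i) h).1 (hpair hij)
            omega
          · have := (twoVarLefschetz_two_iff (hd j) h).1 (hpair hij.symm)
            omega
        let i₂ : Fin n := ⟨2, hn3⟩
        have e1 := hodd h01
        have e2 := hodd (show i₀ ≠ i₂ by simp [i₀, i₂, Fin.ext_iff])
        have e3 := hodd (show i₁ ≠ i₂ by simp [i₁, i₂, Fin.ext_iff])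
        omega
    · right
      have hodd : Odd p := hpp.odd_of_ne_two (by omega)
      by_cases hall : ∀ i, d i < p
      · exact Or.inr (Or.inl ⟨hn2, H.topDeg_lt p hd hc fun i _ => hall i⟩)
      push Not at hall
      obtain ⟨j, hj⟩ := hall
      by_cases hone : ∀ i, i ≠ j → d i < p
      · refine Or.inr (Or.inr ⟨hn2, j, hj, hone, ?_⟩)
        obtain ⟨k, hk⟩ : ∃ k, k ≠ j := by
          by_contra! h
          exact h01 ((h i₀).trans (h i₁).symm)
        rw [baseDigit_zero hp2.le]
        rw [← Finset.insert_erase (Finset.mem_univ j)] at H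
        exact (MonomialCI.lefschetzOn_insert_iff p hd hc (Finset.notMem_erase j _)
          (Finset.mem_erase.2 ⟨hk, Finset.mem_univ k⟩) hj
          fun i hi => hone i (Finset.ne_of_mem_erase hi)).1 H
      push Not at hone
      obtain ⟨i, hij, hi⟩ := hone
      rcases eq_or_lt_of_le (show 2 ≤ n from hn2) with h2 | hn3
      · left
        refine ⟨h2.symm, hp2, ?_⟩
        obtain ⟨i', j', hij', hle, hi'⟩ := hsorted hij
        have hp' : p ≤ d i' := by omega
        obtain ⟨⟨e1, e2⟩, e3, e4, e5⟩ :=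
          (twoVarLefschetz_iff_digits hodd hp2 hp' hle).1 (hpair hij')
        rw [isNearHalf_iff hodd] at e1 e2
        refine ⟨i', j', hij', ?_, ⟨e1, e2⟩, e3, e4, fun _ => e5⟩
        rw [topIndex_eq hp2.le (by omega), topIndex_eq hp2.le (by omega)]
        exact Nat.log_mono_right hle
      · exfalso
        obtain ⟨k, hk⟩ : ∃ k, k ∉ ({i, j} : Finset (Fin n)) := by
          by_contra! h
          have h1 : (Finset.univ : Finset (Fin n)).card ≤ ({i, j} : Finset (Fin n)).card :=
            Finset.card_le_card fun k _ => h k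
          have h2 := Finset.card_le_two (a := i) (b := j)
          rw [Finset.card_univ, Fintype.card_fin] at h1
          omega
        rw [Finset.mem_insert, Finset.mem_singleton, not_or] at hk
        exact MonomialCI.not_lefschetzOn_triple hp2 hd hc hij hk.1 hk.2 hi hj H
  · intro h
    have hc : ∀ i : Fin n, (1 : Fin n → K) i ≠ 0 := fun _ => one_ne_zero
    refine ⟨1, hc, ?_⟩
    have hpair : ∀ {i j : Fin n}, n = 2 → i ≠ j → TwoVarLefschetz K (d i) (d j) →
        MonomialCI.LefschetzOn d (1 : Fin n → K) Finset.univ := by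
      intro i j hn2 hij h
      have huniv : (Finset.univ : Finset (Fin n)) = {j, i} := by
        refine (Finset.eq_of_subset_of_card_le (Finset.subset_univ _) ?_).symm
        rw [Finset.card_pair hij.symm, Finset.card_univ, Fintype.card_fin, hn2]
      rw [huniv]
      exact (MonomialCI.lefschetzOn_pair_iff hd' hc hij).2 h
    rcases h with rfl | ⟨hn2, rfl, i, j, hij, hle, h⟩ | ⟨hn2, hp2, i, j, hij, hle, h⟩ |
      ⟨-, h⟩ | ⟨hn2, j, hj, hone, h⟩
    · rw [Finset.univ_unique]
      exact MonomialCI.lefschetzOn_singleton hd' hc _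
    · refine hpair hn2 hij ((twoVarLefschetz_two_iff (hd i) hle).2 ?_)
      rw [baseDigit_zero le_rfl, baseDigit_eq le_rfl, pow_one] at h
      omega
    · have hodd : Odd p := hpp.odd_of_ne_two (by omega)
      refine hpair hn2 hij ?_
      exact twoVarLefschetz_of_digits hodd hp2 (hd i) (hd j) hle h
    · exact MonomialCI.lefschetzOn_of_topDeg_lt p hd hc h
    · obtain ⟨k, hk⟩ : ∃ k, k ≠ j := by
        by_contra! h
        have := (h ⟨0, by omega⟩).trans (h ⟨1, by omega⟩).symm
        simp [Fin.ext_iff] at this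
      rw [baseDigit_zero hp2] at h
      rw [← Finset.insert_erase (Finset.mem_univ j)]
      exact (MonomialCI.lefschetzOn_insert_iff p hd hc (Finset.notMem_erase j _)
        (Finset.mem_erase.2 ⟨hk, Finset.mem_univ k⟩) hj
        fun i hi => hone i (Finset.ne_of_mem_erase hi)).2 h
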